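/- Let $d\ge 2$ and let $\kappa:(0,\infty)\to[0,1)$ satisfy $\kappa(r)\to\kappa_0\in[0,1]$ as $r\to 0$ (balls: $\kappa\equiv 0$; fixed annuli: $\kappa\equiv\kappa_0<1$; shrinking annuli: $\kappa_0=1$). For $h=r^2>0$ let $A_r(x)=B_r(x)\setminus B_{\kappa(r)r}(x)\subset\mathbb{R}^d$ and, for $\varphi$ on the flat torus $\mathbb{T}^d$ (identified with a $\mathbb{Z}^d$-periodic function on $\mathbb{R}^d$), let $$G_h\varphi(x)=\inf\Big\{m\in\mathbb{R}:\ |\{y\in A_r(x):\varphi(y)\le m\}|\ge\tfrac12|A_r(x)|\Big\}$$ be the continuous median of $\varphi$ over $A_r(x)$. Set $$c_A=\frac{1}{2(d+1)}\,\frac{1-\kappa_0^{d+1}}{1-\kappa_0^{d-1}}\ \text{ if }\kappa_0<1,\qquad c_A=\frac{1}{2(d-1)}\ \text{ if }\kappa_0=1,$$ and, for $p\in\mathbb{R}^d$ and a symmetric matrix $X$ with smallest and largest eigenvalues $\lambda_1$ and $\lambda_d$, let $$F(p,X)=c_A\Big(\operatorname{tr}X-\tfrac{p}{|p|}\cdot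 X\tfrac{p}{|p|}\Big)\ \text{ if }p\ne0,\qquad F(0,X)=c_A\,[\operatorname{tr}X-\lambda_d,\ \operatorname{tr}X-\lambda_1],$$ with semicontinuous envelopes $$F^*(z)=\lim_{\varepsilon\to0}\sup\{v: v\in F(w),\,|w-z|<\varepsilon\},\qquad F_*(z)=\lim_{\varepsilon\to0}\inf\{v: v\in F(w),\,|w-z|<\varepsilon\}.$$ Let $\varphi\in C^\infty(\mathbb{T}^d)$ and let $x$ be a point such that either $\nabla\varphi(x)\neq0$, or $\nabla\varphi(x)=0$ and $\nabla^2\varphi(x)=0$. Then $$\lim_{\varepsilon\to0}\ \sup_{0<h<\varepsilon,\ y\in B_\varepsilon(x)}\frac{G_h\varphi(y)-\varphi(y)}{h}\ \le\ F^*\big(\nabla\varphi(x),\nabla^2\varphi(x)\big),$$ $$\lim_{\varepsilon\to0}\ \inf_{0<h<\varepsilon,\ y\in B_\varepsilon(x)}\frac{G_h\varphi(y)-\varphi(y)}{h}\ \ge\ F_*\big(\nabla\varphi(x),\nabla^2\varphi(x)\big).$$ -/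

import Mathlib

open Set Filter Topology MeasureTheory
open scoped ContDiff

noncomputable section

/-- Functions on the flat torus `𝕋ᵈ = ℝᵈ / ℤᵈ` are the `ℤᵈ`-periodic functions on `ℝᵈ`. -/
def IsTorusPeriodic {d : ℕ} (φ : EuclideanSpace ℝ (Fin d) → ℝ) : Prop :=
  ∀ (k : Fin d → ℤ) (x : EuclideanSpace ℝ (Fin d)),
    φ (x + WithLp.toLp 2 (fun i => (k i : ℝ))) = φ x

/-- The annulus `A_{κ,r}(x) = B_r(x) \ B_{κ r}(x)`; for `κ = 0` it is the ball `B_r(x)`. -/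
def annulus {d : ℕ} (κ r : ℝ) (x : EuclideanSpace ℝ (Fin d)) : Set (EuclideanSpace ℝ (Fin d)) :=
  Metric.ball x r \ Metric.ball x (κ * r)

/-- The continuous median of `φ` over `A`: the least median of `φ` with respect to the uniform
probability measure on `A`, that is, the infimum of all `m` with `ℙ(φ ≤ m) ≥ 1/2`. -/
def continuousMedian {d : ℕ} (φ : EuclideanSpace ℝ (Fin d) → ℝ)
    (A : Set (EuclideanSpace ℝ (Fin d))) : ℝ :=
  sInf {m : ℝ | 1 / 2 ≤ (ProbabilityTheory.cond volume A).real {y | φ y ≤ m}}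

/-- One step `G_h φ` of the median scheme with time step `h = r²`, where the ratio `κ` of the
radii of the stencil may depend on `r`. -/
def medianStep {d : ℕ} (κ : ℝ → ℝ) (h : ℝ) (φ : EuclideanSpace ℝ (Fin d) → ℝ)
    (x : EuclideanSpace ℝ (Fin d)) : ℝ :=
  continuousMedian φ (annulus (κ (√h)) (√h) x)

/-- The Hessian `∇²φ(x)`, as the linear map given by the derivative of the gradient. -/
def hessian {d : ℕ} (φ : EuclideanSpace ℝ (Fin d) → ℝ) (x : EuclideanSpace ℝ (Fin d)) :
    EuclideanSpace ℝ (Fin d) →L[ℝ] EuclideanSpace ℝ (Fin d) :=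
  fderiv ℝ (gradient φ) x

/-- The set of (real) eigenvalues of a linear map. -/
def eigenvalueSet {d : ℕ} (X : EuclideanSpace ℝ (Fin d) →L[ℝ] EuclideanSpace ℝ (Fin d)) : Set ℝ :=
  {μ : ℝ | Module.End.HasEigenvalue
    (X : EuclideanSpace ℝ (Fin d) →ₗ[ℝ] EuclideanSpace ℝ (Fin d)) μ}

/-- The set-valued level set Laplacian `F(p, X)`: the singleton of
`tr X - (p/|p|) · X (p/|p|)` for `p ≠ 0`, and the interval `[tr X - λ_d, tr X - λ_1]` for `p = 0`,
where `λ_1` and `λ_d` are the smallest and the largest eigenvalue of `X`. -/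
def levelSetLaplacian {d : ℕ} (p : EuclideanSpace ℝ (Fin d))
    (X : EuclideanSpace ℝ (Fin d) →L[ℝ] EuclideanSpace ℝ (Fin d)) : Set ℝ :=
  {v : ℝ |
    (p ≠ 0 ∧ v = LinearMap.trace ℝ _
        (X : EuclideanSpace ℝ (Fin d) →ₗ[ℝ] EuclideanSpace ℝ (Fin d))
      - inner ℝ (‖p‖⁻¹ • p) (X (‖p‖⁻¹ • p))) ∨
    (p = 0 ∧ v ∈ Icc
      (LinearMap.trace ℝ _ (X : EuclideanSpace ℝ (Fin d) →ₗ[ℝ] EuclideanSpace ℝ (Fin d))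
        - sSup (eigenvalueSet X))
      (LinearMap.trace ℝ _ (X : EuclideanSpace ℝ (Fin d) →ₗ[ℝ] EuclideanSpace ℝ (Fin d))
        - sInf (eigenvalueSet X)))}

/-- The time-scale constant `c_A` of the stencil in dimension `d`, where `κ₀ ∈ [0, 1]` is the limit
of the ratio of the radii. -/
def stencilConstant (d : ℕ) (κ₀ : ℝ) : ℝ :=
  if κ₀ = 1 then 1 / (2 * ((d : ℝ) - 1))
  else 1 / (2 * ((d : ℝ) + 1)) * ((1 - κ₀ ^ (d + 1)) / (1 - κ₀ ^ (d - 1)))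

/-- The time-rescaled operator `c F`, on pairs (gradient, Hessian). -/
def scaledLevelSetLaplacian {d : ℕ} (c : ℝ)
    (z : EuclideanSpace ℝ (Fin d) × (EuclideanSpace ℝ (Fin d) →L[ℝ] EuclideanSpace ℝ (Fin d))) :
    Set ℝ :=
  (fun v => c * v) '' levelSetLaplacian z.1 z.2

/-- The domain of `F`: pairs of a vector and a symmetric linear map. -/
def symmetricPairs (d : ℕ) :
    Set (EuclideanSpace ℝ (Fin d) × (EuclideanSpace ℝ (Fin d) →L[ℝ] EuclideanSpace ℝ (Fin d))) :=
  {z | (z.2 : EuclideanSpace ℝ (Fin d) →ₗ[ℝ] EuclideanSpace ℝ (Fin d)).IsSymmetric}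

/-- Upper semicontinuous envelope at `z` of a set-valued function `f` with domain `S`:
`lim_{ε → 0} sup {v : v ∈ f(w), w ∈ S ∩ B_ε(z)}`; the limit is the infimum over `ε > 0`, because
the supremum is monotone in `ε`. -/
def upperEnvelope {Z : Type*} [PseudoMetricSpace Z] (S : Set Z) (f : Z → Set ℝ) (z : Z) : EReal :=
  ⨅ (ε : ℝ) (_ : 0 < ε), ⨆ (w : Z) (_ : w ∈ S ∩ Metric.ball z ε) (v : ℝ) (_ : v ∈ f w), (v : EReal)

/-- Lower semicontinuous envelope at `z` of a set-valued function `f` with domain `S`. -/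
def lowerEnvelope {Z : Type*} [PseudoMetricSpace Z] (S : Set Z) (f : Z → Set ℝ) (z : Z) : EReal :=
  ⨆ (ε : ℝ) (_ : 0 < ε), ⨅ (w : Z) (_ : w ∈ S ∩ Metric.ball z ε) (v : ℝ) (_ : v ∈ f w), (v : EReal)

/-- Upper half-relaxed limit as `h → 0`:
`lim_{ε → 0} sup {f_h(y) : 0 < h < ε, y ∈ B_ε(x)}`. -/
def upperHalfRelaxedLimit {Z : Type*} [PseudoMetricSpace Z] (f : ℝ → Z → ℝ) (x : Z) : EReal :=
  ⨅ (ε : ℝ) (_ : 0 < ε), ⨆ (h : ℝ) (_ : h ∈ Ioo 0 ε) (y : Z) (_ : y ∈ Metric.ball x ε),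
    (f h y : EReal)

/-- Lower half-relaxed limit as `h → 0`:
`lim_{ε → 0} inf {f_h(y) : 0 < h < ε, y ∈ B_ε(x)}`. -/
def lowerHalfRelaxedLimit {Z : Type*} [PseudoMetricSpace Z] (f : ℝ → Z → ℝ) (x : Z) : EReal :=
  ⨆ (ε : ℝ) (_ : 0 < ε), ⨅ (h : ℝ) (_ : h ∈ Ioo 0 ε) (y : Z) (_ : y ∈ Metric.ball x ε),
    (f h y : EReal)

end

/-! A median over an annulus is at most `m` as soon as the sublevel set at height `m` fills more
than half of it. The theorem thus reduces to one claim: if `m` exceeds the speed `c_A (tr X - e · X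
e)`, where `e = p / |p|`, then `{φ < φ(y) + m r²}` fills more than half of `A_r(y)` for all `(r, y)`
near `(0, x)`. This bounds the upper limit by the value of `F` at the point itself, which the
envelope dominates. The lower bound is the same claim for `-φ`, since the speed is odd.

If the Hessian vanishes at `x`, the quadratic Taylor term is at most `(m/2) r²` near `x`. After
rescaling, the sublevel set then contains a half-space shifted by a positive amount, and the shift
gains a slab of positive measure (`eventually_half_lt_volume_sublevel_of_degenerate`).

If the gradient `p` is nonzero, rotate `p / |p|` to the first axis. The half-space `v₀ ≤ 0` has at
least half of the volume, so it suffices that the sublevel set exceeds it, that is, that the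
integral of the difference of the two indicators is positive. This difference lives in a layer of
thickness `O(r)`. Write a point as a radius `ρ = κ + (1 - κ) u` times the direction of `(r s / ρ,
w)` in the unit ball. This pulls out the factor `(1 - κ) r` exactly and leaves an integral that
converges even when `κ → 1` (`setIntegral_annulus_eq_rescaled`). In the limit the sublevel set
becomes `s < t(ρ, w)` with `t = (m |w| - (ρ²/2) X(w, w) / |w|) / |p|`, and dominated convergence
applies (`tendsto_integral_rescaledIntegrand`). Integrating over `s` gives `t`. Isotropy in `w`
turns `X(w, w)` into a tangential trace, and the moments of `ρ^(d-2)` and `ρ^d` produce `c_A`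
(`stencilConstant_mul_integral`). The limit has the sign of `m` minus the speed. -/

/-! ### Hessians and second-order Taylor expansion. -/

section Calculus

variable {d : ℕ} {φ : EuclideanSpace ℝ (Fin d) → ℝ}

lemma gradient_neg_fun (φ : EuclideanSpace ℝ (Fin d) → ℝ) :
    gradient (fun y => -φ y) = fun y => -gradient φ y := by
  funext y
  simp [gradient, fderiv_fun_neg]

lemma hessian_neg_fun (φ : EuclideanSpace ℝ (Fin d) → ℝ) (x : EuclideanSpace ℝ (Fin d)) :
    hessian (fun y => -φ y) x = -hessian φ x := by
  unfold hessian
  rw [gradient_neg_fun, fderiv_fun_neg]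

lemma two_le_infty : (2 : WithTop ℕ∞) ≤ ∞ := by
  exact WithTop.coe_le_coe.2 (le_top : (2 : ℕ∞) ≤ ⊤)

lemma contDiff_gradient (hφ : ContDiff ℝ ∞ φ) : ContDiff ℝ 1 (gradient φ) := by
  have h : ContDiff ℝ 1 (fderiv ℝ φ) := hφ.fderiv_right (by simpa [one_add_one_eq_two] using two_le_infty)
  exact (InnerProductSpace.toDual ℝ (EuclideanSpace ℝ (Fin d))).symm.toContinuousLinearEquiv.toContinuousLinearMap.contDiff.comp h

lemma continuous_gradient (hφ : ContDiff ℝ ∞ φ) : Continuous (gradient φ) :=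
  (contDiff_gradient hφ).continuous

lemma continuous_hessian (hφ : ContDiff ℝ ∞ φ) : Continuous (hessian φ) :=
  (contDiff_gradient hφ).continuous_fderiv (by norm_num)

lemma hasFDerivAt_gradient (hφ : ContDiff ℝ ∞ φ) (x : EuclideanSpace ℝ (Fin d)) :
    HasFDerivAt (gradient φ) (hessian φ x) x :=
  ((contDiff_gradient hφ).differentiable (by norm_num) x).hasFDerivAt

/-- The envelopes range over symmetric pairs only, so the value at the centre counts only once this
is known. -/
lemma isSymmetric_hessian (hφ : ContDiff ℝ ∞ φ) (x : EuclideanSpace ℝ (Fin d)) :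
    (hessian φ x : EuclideanSpace ℝ (Fin d) →ₗ[ℝ] EuclideanSpace ℝ (Fin d)).IsSymmetric := by
  have hsym : IsSymmSndFDerivAt ℝ φ x :=
    hφ.contDiffAt.isSymmSndFDerivAt (by simpa using two_le_infty)
  have hf : ∀ v w, fderiv ℝ (fderiv ℝ φ) x v w = inner ℝ (hessian φ x v) w := by
    intro v w
    have h1 : fderiv ℝ φ = fun y => InnerProductSpace.toDual ℝ _ (gradient φ y) := by
      funext y; simp
    have h2 : HasFDerivAt (fun y => InnerProductSpace.toDual ℝ _ (gradient φ y))
        ((InnerProductSpace.toDual ℝ (EuclideanSpace ℝ (Fin d))).toContinuousLinearEquiv.toContinuousLinearMap.comp (hessian φ x)) x :=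
      (ContinuousLinearMap.hasFDerivAt (InnerProductSpace.toDual ℝ (EuclideanSpace ℝ (Fin d))).toContinuousLinearEquiv.toContinuousLinearMap).comp x (hasFDerivAt_gradient hφ x)
    rw [h1, h2.fderiv]
    simp
  intro v w
  have := hsym v w
  rw [hf, hf] at this
  simp only [ContinuousLinearMap.coe_coe]
  rw [this, real_inner_comm]

lemma exists_taylor_two (hφ : ContDiff ℝ ∞ φ) (y v : EuclideanSpace ℝ (Fin d)) :
    ∃ ξ ∈ Icc (0 : ℝ) 1, φ (y + v) = φ y + inner ℝ (gradient φ y) v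
      + inner ℝ (hessian φ (y + ξ • v) v) v / 2 := by
  have hl : ∀ t : ℝ, HasDerivAt (fun t : ℝ => y + t • v) v t := fun t => by
    simpa using ((hasDerivAt_id t).smul_const v).const_add y
  have h1 : ∀ t : ℝ, HasDerivAt (fun t : ℝ => φ (y + t • v)) (inner ℝ (gradient φ (y + t • v)) v) t := by
    intro t
    have := ((hφ.differentiable (by simp)) (y + t • v)).hasFDerivAt.comp_hasDerivAt t (hl t)
    simpa [gradient, Function.comp_def] using this
  have h2 : ∀ t : ℝ, HasDerivAt (fun t : ℝ => inner ℝ (gradient φ (y + t • v)) v)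
      (inner ℝ (hessian φ (y + t • v) v) v) t := by
    intro t
    have := ((hasFDerivAt_gradient hφ (y + t • v)).comp_hasDerivAt t (hl t)).inner ℝ (hasDerivAt_const t v)
    simpa [Function.comp_def] using this
  have hd1 : deriv (fun t : ℝ => φ (y + t • v)) = fun t => inner ℝ (gradient φ (y + t • v)) v :=
    funext fun t => (h1 t).deriv
  have hd2 : deriv (fun t : ℝ => inner ℝ (gradient φ (y + t • v)) v) =
      fun t => inner ℝ (hessian φ (y + t • v) v) v := funext fun t => (h2 t).deriv
  have hC : ContDiff ℝ 2 (fun t : ℝ => φ (y + t • v)) :=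
    (hφ.of_le (two_le_infty)).comp (contDiff_const.add (contDiff_id.smul contDiff_const))
  obtain ⟨ξ, hξ, h⟩ := taylor_mean_remainder_lagrange_iteratedDeriv (n := 1) (x := 1) (x₀ := 0)
    (zero_ne_one) (f := fun t : ℝ => φ (y + t • v)) (by simpa [one_add_one_eq_two] using hC.contDiffOn)
  simp only [zero_le_one, uIoo_of_le, uIcc_of_le] at hξ h
  refine ⟨ξ, ⟨hξ.1.le, hξ.2.le⟩, ?_⟩
  have hu : UniqueDiffWithinAt ℝ (Icc (0 : ℝ) 1) 0 := uniqueDiffOn_Icc zero_lt_one 0 (by simp)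
  rw [taylorWithinEval_succ, taylor_within_zero_eval, iteratedDerivWithin_one,
    (h1 0).hasDerivWithinAt.derivWithin hu, iteratedDeriv_succ, iteratedDeriv_one, hd1, hd2] at h
  simp at h
  have hg : fderiv ℝ φ y v = inner ℝ (gradient φ y) v := by simp [gradient]
  linarith

/-- Continuity of the Hessian makes the remainder bound uniform in the base point as well as the
direction, as half-relaxed limits require. -/
lemma eventually_taylor_bound (hφ : ContDiff ℝ ∞ φ) {x : EuclideanSpace ℝ (Fin d)} {M : ℝ}
    (hM : ‖hessian φ x‖ < M) :
    ∀ᶠ q : ℝ × EuclideanSpace ℝ (Fin d) in 𝓝[>] 0 ×ˢ 𝓝 x, ∀ v, ‖v‖ ≤ 1 →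
      |φ (q.2 + q.1 • v) - φ q.2 - q.1 * inner ℝ (gradient φ q.2) v| ≤ M / 2 * q.1 ^ 2 := by
  have hX : ∀ᶠ y in 𝓝 x, ‖hessian φ y‖ < M :=
    (continuous_hessian hφ).norm.continuousAt.eventually_lt continuousAt_const hM
  obtain ⟨δ, hδ, H⟩ := Metric.eventually_nhds_iff_ball.1 hX
  have hr := Eventually.prod_inl (p := fun r => r ∈ Ioo 0 (δ / 2))
    (Ioo_mem_nhdsGT (half_pos hδ)) (𝓝 x)
  have hy := Eventually.prod_inr (p := fun y => y ∈ Metric.ball x (δ / 2))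
    (Metric.ball_mem_nhds x (half_pos hδ)) (𝓝[>] (0 : ℝ))
  filter_upwards [hr, hy] with ⟨r, y⟩ hr hy v hv
  simp only at hr hy ⊢
  obtain ⟨ξ, hξ, h⟩ := exists_taylor_two hφ y (r • v)
  have hb : y + ξ • r • v ∈ Metric.ball x δ := by
    have h1 : ‖ξ • r • v‖ ≤ r := by
      rw [norm_smul, norm_smul, Real.norm_of_nonneg hξ.1, Real.norm_of_nonneg hr.1.le]
      have := mul_le_of_le_one_right hr.1.le hv
      exact (mul_le_of_le_one_left (mul_nonneg hr.1.le (norm_nonneg v)) hξ.2).trans this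
    rw [Metric.mem_ball, dist_eq_norm] at hy ⊢
    calc ‖y + ξ • r • v - x‖ = ‖(y - x) + ξ • r • v‖ := by congr 1; abel
      _ ≤ ‖y - x‖ + ‖ξ • r • v‖ := norm_add_le _ _
      _ < δ := by linarith [hr.2]
  have hH := (H _ hb).le
  rw [h, inner_smul_right, map_smul, inner_smul_left, inner_smul_right]
  simp only [conj_trivial]
  set X := hessian φ (y + ξ • r • v)
  have hq : |inner ℝ (X v) v| ≤ M := by
    calc |inner ℝ (X v) v| ≤ ‖X v‖ * ‖v‖ := abs_real_inner_le_norm _ _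
      _ ≤ (‖X‖ * ‖v‖) * ‖v‖ := by gcongr; exact X.le_opNorm v
      _ ≤ (‖X‖ * 1) * 1 := by gcongr
      _ ≤ M := by linarith
  have e : φ y + r * inner ℝ (gradient φ y) v + r * (r * inner ℝ (X v) v) / 2 - φ y
      - r * inner ℝ (gradient φ y) v = r ^ 2 * (inner ℝ (X v) v / 2) := by ring
  rw [e, abs_mul, abs_of_nonneg (sq_nonneg r), mul_comm, abs_div, abs_two]
  gcongr

end Calculus

/-! ### Medians and volumes of sublevel sets. -/

section Median

variable {d : ℕ} {φ : EuclideanSpace ℝ (Fin d) → ℝ}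

lemma annulus_subset_closedBall (κ r : ℝ) (x : EuclideanSpace ℝ (Fin d)) :
    annulus κ r x ⊆ Metric.closedBall x r :=
  fun _ hy => Metric.ball_subset_closedBall hy.1

lemma measurableSet_annulus (κ r : ℝ) (x : EuclideanSpace ℝ (Fin d)) :
    MeasurableSet (annulus κ r x) :=
  Metric.isOpen_ball.measurableSet.diff Metric.isOpen_ball.measurableSet

lemma volume_annulus_ne_top (κ r : ℝ) (x : EuclideanSpace ℝ (Fin d)) :
    volume (annulus κ r x) ≠ ⊤ :=
  ((measure_mono (annulus_subset_closedBall κ r x)).trans_lt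
    (isCompact_closedBall x r).measure_lt_top).ne

lemma cond_annulus_real (κ r : ℝ) (x : EuclideanSpace ℝ (Fin d))
    (s : Set (EuclideanSpace ℝ (Fin d))) :
    (ProbabilityTheory.cond volume (annulus κ r x)).real s =
      (volume.real (annulus κ r x))⁻¹ * volume.real (annulus κ r x ∩ s) := by
  rw [measureReal_def, ProbabilityTheory.cond_apply (measurableSet_annulus κ r x),
    ENNReal.toReal_mul, ENNReal.toReal_inv]
  rfl

lemma bddBelow_medians (hφ : Continuous φ) (κ r : ℝ) (x : EuclideanSpace ℝ (Fin d)) :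
    BddBelow {m : ℝ | 1 / 2 ≤ (ProbabilityTheory.cond volume (annulus κ r x)).real {y | φ y ≤ m}} := by
  obtain ⟨b, hb⟩ := ((isCompact_closedBall x r).image hφ).bddBelow
  refine ⟨b, fun m hm => ?_⟩
  by_contra! h
  have hempty : annulus κ r x ∩ {y | φ y ≤ m} = ∅ := by
    ext y
    simp only [mem_inter_iff, mem_ofPred_eq, mem_empty_iff_false, iff_false, not_and, not_le]
    intro hy
    exact h.trans_le (hb (mem_image_of_mem φ (annulus_subset_closedBall κ r x hy)))
  rw [mem_ofPred_eq, cond_annulus_real, hempty] at hm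
  norm_num at hm

lemma continuousMedian_le (hφ : Continuous φ) {κ r : ℝ} {x : EuclideanSpace ℝ (Fin d)} {m : ℝ}
    (h : volume.real (annulus κ r x) < 2 * volume.real (annulus κ r x ∩ {y | φ y < m})) :
    continuousMedian φ (annulus κ r x) ≤ m := by
  refine csInf_le (bddBelow_medians hφ κ r x) ?_
  have hmono : volume.real (annulus κ r x ∩ {y | φ y < m}) ≤
      volume.real (annulus κ r x ∩ {y | φ y ≤ m}) :=
    measureReal_mono (inter_subset_inter_right _ fun y (hy : φ y < m) => hy.le)
      (measure_ne_top_of_subset inter_subset_left (volume_annulus_ne_top κ r x))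
  have hle : volume.real (annulus κ r x ∩ {y | φ y < m}) ≤ volume.real (annulus κ r x) :=
    measureReal_mono inter_subset_left (volume_annulus_ne_top κ r x)
  -- Strictness in the hypothesis rules out a null annulus, on which the conditional measure would
  -- vanish.
  have hpos : 0 < volume.real (annulus κ r x) := by
    have := measureReal_nonneg (μ := volume) (s := annulus κ r x); linarith
  rw [mem_ofPred_eq, cond_annulus_real, inv_mul_eq_div, div_le_div_iff₀ two_pos hpos]
  linarith

/-- If `φ > m` on more than half of the annulus, no level below `m` can collect half of it. The
hypothesis is phrased for `-φ` so that the sublevel estimate can be reused. -/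
lemma le_continuousMedian (hφ : Continuous φ) {κ r : ℝ} {x : EuclideanSpace ℝ (Fin d)} {m : ℝ}
    (h : volume.real (annulus κ r x) < 2 * volume.real (annulus κ r x ∩ {y | -φ y < -m})) :
    m ≤ continuousMedian φ (annulus κ r x) := by
  have hle : volume.real (annulus κ r x ∩ {y | -φ y < -m}) ≤ volume.real (annulus κ r x) :=
    measureReal_mono inter_subset_left (volume_annulus_ne_top κ r x)
  have hpos : 0 < volume.real (annulus κ r x) := by
    have := measureReal_nonneg (μ := volume) (s := annulus κ r x); linarith
  refine le_csInf ?_ fun m' hm' => ?_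
  -- An upper bound of `φ` on the ball is an admissible level, so the infimum is not the default
  -- value of an empty set.
  · obtain ⟨b, hb⟩ := ((isCompact_closedBall x r).image hφ).bddAbove
    refine ⟨b, ?_⟩
    have hsub : annulus κ r x ∩ {y | φ y ≤ b} = annulus κ r x :=
      inter_eq_left.2 fun y hy =>
        hb (mem_image_of_mem φ (annulus_subset_closedBall κ r x hy))
    rw [mem_ofPred_eq, cond_annulus_real, hsub, inv_mul_cancel₀ hpos.ne']
    norm_num
  · by_contra! hlt
    rw [mem_ofPred_eq, cond_annulus_real, inv_mul_eq_div, div_le_div_iff₀ two_pos hpos] at hm'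
    have hdisj : Disjoint (annulus κ r x ∩ {y | φ y ≤ m'}) (annulus κ r x ∩ {y | -φ y < -m}) := by
      rw [Set.disjoint_left]
      rintro y ⟨-, hy⟩ ⟨-, hy'⟩
      simp only [mem_ofPred_eq] at hy hy'
      linarith
    have hmeas : MeasurableSet (annulus κ r x ∩ {y | -φ y < -m}) :=
      (measurableSet_annulus κ r x).inter
        (isOpen_lt hφ.neg continuous_const).measurableSet
    have hfin : ∀ s, volume (annulus κ r x ∩ s) ≠ ⊤ := fun s =>
      measure_ne_top_of_subset inter_subset_left (volume_annulus_ne_top κ r x)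
    have hun := measureReal_union hdisj hmeas (μ := volume) (hfin _) (hfin _)
    have hsub : volume.real (annulus κ r x ∩ {y | φ y ≤ m'} ∪ annulus κ r x ∩ {y | -φ y < -m}) ≤
        volume.real (annulus κ r x) :=
      measureReal_mono (union_subset inter_subset_left inter_subset_left)
        (volume_annulus_ne_top κ r x)
    linarith

end Median

/-! ### Envelopes and half-relaxed limits. -/

section HalfRelaxedLimits

variable {d : ℕ}

/-- The value of the rescaled level set Laplacian at a pair with nonzero vector or zero matrix. -/
noncomputable def levelSetSpeed (c : ℝ) (p : EuclideanSpace ℝ (Fin d))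
    (X : EuclideanSpace ℝ (Fin d) →L[ℝ] EuclideanSpace ℝ (Fin d)) : ℝ :=
  c * (LinearMap.trace ℝ _ (X : EuclideanSpace ℝ (Fin d) →ₗ[ℝ] EuclideanSpace ℝ (Fin d))
    - inner ℝ (‖p‖⁻¹ • p) (X (‖p‖⁻¹ • p)))

lemma levelSetSpeed_neg (c : ℝ) (p : EuclideanSpace ℝ (Fin d))
    (X : EuclideanSpace ℝ (Fin d) →L[ℝ] EuclideanSpace ℝ (Fin d)) :
    levelSetSpeed c (-p) (-X) = -levelSetSpeed c p X := by
  simp [levelSetSpeed]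
  ring

/-- For `p = 0` and `X = 0` the only eigenvalue is `0`, so the interval collapses to the point that
the convention `‖0‖⁻¹ = 0` also gives. -/
lemma levelSetSpeed_mem (hd : 2 ≤ d) (c : ℝ) {p : EuclideanSpace ℝ (Fin d)}
    {X : EuclideanSpace ℝ (Fin d) →L[ℝ] EuclideanSpace ℝ (Fin d)} (h : p = 0 → X = 0) :
    levelSetSpeed c p X ∈ scaledLevelSetLaplacian c (p, X) := by
  refine ⟨_, ?_, rfl⟩
  by_cases hp : p = 0
  · right
    have hX := h hp
    subst hX
    have : Nontrivial (EuclideanSpace ℝ (Fin d)) := by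
      have : NeZero d := ⟨by omega⟩
      infer_instance
    have he : eigenvalueSet (0 : EuclideanSpace ℝ (Fin d) →L[ℝ] EuclideanSpace ℝ (Fin d)) = {0} := by
      ext μ
      simp only [eigenvalueSet, mem_ofPred_eq, mem_singleton_iff]
      constructor
      · intro hμ
        obtain ⟨v, hv⟩ := hμ.exists_hasEigenvector
        have := hv.apply_eq_smul
        simpa [hv.2, eq_comm] using this
      · rintro rfl
        obtain ⟨v, hv⟩ := exists_ne (0 : EuclideanSpace ℝ (Fin d))
        exact Module.End.hasEigenvalue_of_hasEigenvector (x := v) ⟨by simp, hv⟩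
    simp [hp, he]
  · left
    exact ⟨hp, rfl⟩

lemma le_upperEnvelope_of_mem {Z : Type*} [PseudoMetricSpace Z] {S : Set Z} {f : Z → Set ℝ} {z : Z}
    {v : ℝ} (hz : z ∈ S) (hv : v ∈ f z) : (v : EReal) ≤ upperEnvelope S f z := by
  refine le_iInf₂ fun ε hε => ?_
  exact le_iSup_of_le z <| le_iSup_of_le ⟨hz, Metric.mem_ball_self hε⟩ <|
    le_iSup_of_le v <| le_iSup_of_le hv le_rfl

lemma lowerEnvelope_le_of_mem {Z : Type*} [PseudoMetricSpace Z] {S : Set Z} {f : Z → Set ℝ} {z : Z}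
    {v : ℝ} (hz : z ∈ S) (hv : v ∈ f z) : lowerEnvelope S f z ≤ (v : EReal) := by
  refine iSup₂_le fun ε hε => ?_
  exact iInf_le_of_le z <| iInf_le_of_le ⟨hz, Metric.mem_ball_self hε⟩ <|
    iInf_le_of_le v <| iInf_le_of_le hv le_rfl

/-- The limits run over time steps `h`, the geometric estimates over radii `r = √h`. -/
lemma exists_forall_of_eventually_sqrt {Z : Type*} [PseudoMetricSpace Z] {x : Z}
    {P : ℝ → Z → Prop} (h : ∀ᶠ q : ℝ × Z in 𝓝[>] 0 ×ˢ 𝓝 x, P q.1 q.2) :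
    ∃ ε > 0, ∀ h ∈ Ioo 0 ε, ∀ y ∈ Metric.ball x ε, P (√h) y := by
  have hs : Tendsto (fun h : ℝ => √h) (𝓝[>] 0) (𝓝[>] 0) := by
    refine tendsto_nhdsWithin_iff.2 ⟨?_, ?_⟩
    · have := (Real.continuous_sqrt.tendsto 0).mono_left (nhdsWithin_le_nhds (s := Ioi 0))
      simpa using this
    · filter_upwards [self_mem_nhdsWithin] with h hh using Real.sqrt_pos.2 hh
  have h2 := (hs.prodMap tendsto_id).eventually h
  obtain ⟨pa, ha, pb, hb, hab⟩ := eventually_prod_iff.1 h2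
  obtain ⟨ε₁, h1, h1'⟩ := mem_nhdsGT_iff_exists_Ioo_subset.1 ha
  obtain ⟨ε₂, h2, h2'⟩ := Metric.eventually_nhds_iff_ball.1 hb
  exact ⟨min ε₁ ε₂, lt_min h1 h2, fun h hh y hy =>
    hab (h1' ⟨hh.1, hh.2.trans_le (min_le_left _ _)⟩)
      (h2' y (Metric.ball_subset_ball (min_le_right _ _) hy))⟩

lemma upperHalfRelaxedLimit_le {Z : Type*} [PseudoMetricSpace Z] {x : Z} {f : ℝ → Z → ℝ} {v : ℝ}
    (h : ∀ m > v, ∀ᶠ q : ℝ × Z in 𝓝[>] 0 ×ˢ 𝓝 x, f (q.1 ^ 2) q.2 ≤ m) :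
    upperHalfRelaxedLimit f x ≤ v := by
  refine EReal.le_of_forall_lt_iff_le.1 fun m hm => ?_
  obtain ⟨ε, hε, H⟩ := exists_forall_of_eventually_sqrt (P := fun r y => f (r ^ 2) y ≤ m)
    (h m (EReal.coe_lt_coe_iff.1 hm))
  refine iInf₂_le_of_le ε hε ?_
  refine iSup₂_le fun t ht => iSup₂_le fun y hy => ?_
  have := H t ht y hy
  rw [Real.sq_sqrt ht.1.le] at this
  exact_mod_cast this

lemma le_lowerHalfRelaxedLimit {Z : Type*} [PseudoMetricSpace Z] {x : Z} {f : ℝ → Z → ℝ} {v : ℝ}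
    (h : ∀ m < v, ∀ᶠ q : ℝ × Z in 𝓝[>] 0 ×ˢ 𝓝 x, m ≤ f (q.1 ^ 2) q.2) :
    (v : EReal) ≤ lowerHalfRelaxedLimit f x := by
  refine EReal.ge_of_forall_gt_iff_ge.1 fun m hm => ?_
  obtain ⟨ε, hε, H⟩ := exists_forall_of_eventually_sqrt (P := fun r y => m ≤ f (r ^ 2) y)
    (h m (EReal.coe_lt_coe_iff.1 hm))
  refine le_iSup₂_of_le ε hε ?_
  refine le_iInf₂ fun t ht => le_iInf₂ fun y hy => ?_
  have := H t ht y hy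
  rw [Real.sq_sqrt ht.1.le] at this
  exact_mod_cast this

end HalfRelaxedLimits

/-! ### Half-spaces in the unit annulus. -/

section HalfMeasure

variable {d : ℕ}

lemma volume_real_preimage_similarity (y : EuclideanSpace ℝ (Fin d)) {r : ℝ} (hr : 0 < r)
    (O : EuclideanSpace ℝ (Fin d) ≃ₗᵢ[ℝ] EuclideanSpace ℝ (Fin d))
    (s : Set (EuclideanSpace ℝ (Fin d))) :
    volume.real {z | y + r • O z ∈ s} = (r ^ d)⁻¹ * volume.real s := by
  have h : {z | y + r • O z ∈ s} =
      O.toMeasurableEquiv ⁻¹' ((fun z => r • z) ⁻¹' ((fun z => y + z) ⁻¹' s)) := rfl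
  rw [measureReal_def, h, O.measurePreserving.measure_preimage_equiv (f := O.toMeasurableEquiv),
    Measure.addHaar_preimage_smul _ hr.ne', measure_preimage_add, ENNReal.toReal_mul,
    ENNReal.toReal_ofReal (abs_nonneg _), finrank_euclideanSpace_fin, abs_of_pos (by positivity)]
  rfl

lemma mem_annulus_similarity (κ : ℝ) (y : EuclideanSpace ℝ (Fin d)) {r : ℝ} (hr : 0 < r)
    (O : EuclideanSpace ℝ (Fin d) ≃ₗᵢ[ℝ] EuclideanSpace ℝ (Fin d))
    (z : EuclideanSpace ℝ (Fin d)) :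
    y + r • O z ∈ annulus κ r y ↔ z ∈ annulus κ 1 0 := by
  have h1 : r * ‖z‖ < r ↔ ‖z‖ < 1 := by
    simpa using mul_lt_mul_iff_right₀ hr (b := ‖z‖) (c := 1)
  have h2 : r * ‖z‖ < κ * r ↔ ‖z‖ < κ := by
    rw [mul_comm κ]; exact mul_lt_mul_iff_right₀ hr
  simp [annulus, norm_smul, abs_of_pos hr, -not_lt, h1, h2]

/-- A set fills more than half of an annulus if its rescaling does so for the unit annulus. -/
lemma half_lt_of_similarity (κ : ℝ) (y : EuclideanSpace ℝ (Fin d)) {r : ℝ} (hr : 0 < r)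
    (O : EuclideanSpace ℝ (Fin d) ≃ₗᵢ[ℝ] EuclideanSpace ℝ (Fin d))
    (s : Set (EuclideanSpace ℝ (Fin d)))
    (h : volume.real (annulus κ 1 (0 : EuclideanSpace ℝ (Fin d))) <
      2 * volume.real (annulus κ 1 0 ∩ {z | y + r • O z ∈ s})) :
    volume.real (annulus κ r y) < 2 * volume.real (annulus κ r y ∩ s) := by
  have h1 := volume_real_preimage_similarity y hr O (annulus κ r y)
  have h2 := volume_real_preimage_similarity y hr O (annulus κ r y ∩ s)
  simp only [mem_inter_iff, mem_annulus_similarity κ y hr O] at h1 h2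
  have e1 : {z : EuclideanSpace ℝ (Fin d) | z ∈ annulus κ 1 0} = annulus κ 1 0 := rfl
  have e2 : {z : EuclideanSpace ℝ (Fin d) | z ∈ annulus κ 1 0 ∧ y + r • O z ∈ s} =
    annulus κ 1 0 ∩ {z | y + r • O z ∈ s} := rfl
  rw [e1] at h1
  rw [e2] at h2
  rw [h1, h2, mul_left_comm] at h
  exact lt_of_mul_lt_mul_left h (by positivity)

lemma neg_mem_annulus_zero {κ r : ℝ} {z : EuclideanSpace ℝ (Fin d)} :
    -z ∈ annulus κ r 0 ↔ z ∈ annulus κ r 0 := by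
  simp [annulus]

lemma volume_real_annulus_inter_neg (κ r : ℝ) (s : Set (EuclideanSpace ℝ (Fin d))) :
    volume.real (annulus κ r 0 ∩ {z | -z ∈ s}) = volume.real (annulus κ r 0 ∩ s) := by
  have : annulus κ r 0 ∩ {z | -z ∈ s} = -(annulus κ r 0 ∩ s) := by
    ext z
    simp [neg_mem_annulus_zero]
  rw [this, measureReal_def, Measure.measure_neg]
  rfl

/-- The half-space and its image under `z ↦ -z` cover the annulus and meet it in equal volumes. -/
lemma volume_annulus_le_two_mul_halfspace (κ r : ℝ) (p : EuclideanSpace ℝ (Fin d)) :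
    volume.real (annulus κ r (0 : EuclideanSpace ℝ (Fin d))) ≤
      2 * volume.real (annulus κ r 0 ∩ {z | inner ℝ p z ≤ 0}) := by
  have h := volume_real_annulus_inter_neg κ r {z | inner ℝ p z ≤ 0}
  have hcov : annulus κ r 0 = annulus κ r 0 ∩ {z | inner ℝ p z ≤ 0} ∪
      annulus κ r 0 ∩ {z | -z ∈ {z | inner ℝ p z ≤ 0}} := by
    rw [← inter_union_distrib_left, eq_comm, inter_eq_left]
    intro z _
    simpa using le_total _ _
  have := measureReal_union_le (μ := volume) (annulus κ r 0 ∩ {z | inner ℝ p z ≤ 0})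
    (annulus κ r 0 ∩ {z | -z ∈ {z | inner ℝ p z ≤ 0}})
  rw [← hcov, h] at this
  linarith

lemma exists_inner_eq_zero_norm_eq (hd : 2 ≤ d) (p : EuclideanSpace ℝ (Fin d)) {t : ℝ} (ht : 0 ≤ t) :
    ∃ z : EuclideanSpace ℝ (Fin d), inner ℝ p z = 0 ∧ ‖z‖ = t := by
  have hne : (ℝ ∙ p)ᗮ ≠ ⊥ := by
    intro h
    have h1 := Submodule.finrank_add_finrank_orthogonal (ℝ ∙ p)
    have h2 : Module.finrank ℝ (ℝ ∙ p) ≤ 1 := by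
      simpa using finrank_span_le_card (R := ℝ) ({p} : Set (EuclideanSpace ℝ (Fin d)))
    rw [h, finrank_bot, finrank_euclideanSpace_fin] at h1
    omega
  obtain ⟨v, hv, hv0⟩ := Submodule.exists_mem_ne_zero_of_ne_bot hne
  refine ⟨(t * ‖v‖⁻¹) • v, ?_, ?_⟩
  · rw [inner_smul_right, Submodule.mem_orthogonal_singleton_iff_inner_right.1 hv, mul_zero]
  · rw [norm_smul, norm_mul, norm_inv, norm_norm, mul_assoc,
      inv_mul_cancel₀ (norm_ne_zero_iff.2 hv0), mul_one, Real.norm_of_nonneg ht]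

/-- By inclusion-exclusion for the shifted half-space and its reflection, the gain is the volume of
their overlap, a slab around a hyperplane through the centre. No lower bound on `p` enters, so the
gradient may vanish or vary freely. -/
lemma volume_annulus_lt_two_mul_halfspace (hd : 2 ≤ d) {κ : ℝ} (hκ : κ ∈ Ico (0 : ℝ) 1)
    (p : EuclideanSpace ℝ (Fin d)) {c : ℝ} (hc : 0 < c) :
    volume.real (annulus κ 1 (0 : EuclideanSpace ℝ (Fin d))) <
      2 * volume.real (annulus κ 1 0 ∩ {z | inner ℝ p z < c}) := by
  have hfin : ∀ s, volume (annulus κ 1 (0 : EuclideanSpace ℝ (Fin d)) ∩ s) ≠ ⊤ := fun s =>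
    measure_ne_top_of_subset inter_subset_left (volume_annulus_ne_top κ 1 _)
  have hcont : Continuous fun z : EuclideanSpace ℝ (Fin d) => inner ℝ p z := by fun_prop
  have h := volume_real_annulus_inter_neg κ 1 {z | inner ℝ p z < c}
  set A := annulus κ 1 (0 : EuclideanSpace ℝ (Fin d)) with hA
  set H := {z : EuclideanSpace ℝ (Fin d) | inner ℝ p z < c} with hH
  have hcov : A ∩ H ∪ A ∩ {z | -z ∈ H} = A := by
    rw [← inter_union_distrib_left, inter_eq_left]
    intro z _
    by_cases hz : inner ℝ p z < c
    · exact Or.inl hz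
    · refine Or.inr ?_
      change inner ℝ p (-z) < c
      rw [inner_neg_right]
      linarith
  have hmH : MeasurableSet H := (isOpen_lt hcont continuous_const).measurableSet
  have hui := measureReal_union_add_inter (μ := volume) (s := A ∩ H) (t := A ∩ {z | -z ∈ H})
    ((measurableSet_annulus κ 1 0).inter (measurable_neg hmH)) (hfin _) (hfin _)
  rw [hcov, h] at hui
  -- Strict inequalities make this part of the overlap open. A vector orthogonal to `p` of the
  -- intermediate norm `(κ + 1) / 2` lies in it.
  set U := (Metric.ball (0 : EuclideanSpace ℝ (Fin d)) 1 ∩ {z | κ < ‖z‖}) ∩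
    (H ∩ {z | -c < inner ℝ p z}) with hU
  have hUo : IsOpen U :=
    (Metric.isOpen_ball.inter (isOpen_lt continuous_const continuous_norm)).inter
      ((isOpen_lt hcont continuous_const).inter (isOpen_lt continuous_const hcont))
  have hUn : U.Nonempty := by
    obtain ⟨z, hz, hn⟩ := exists_inner_eq_zero_norm_eq hd p (t := (κ + 1) / 2) (by linarith [hκ.1])
    refine ⟨z, ⟨?_, ?_⟩, ?_, ?_⟩
    · simp only [Metric.mem_ball, dist_zero_right, hn]; linarith [hκ.2]
    · simp only [mem_ofPred_eq, hn]; linarith [hκ.2]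
    · simpa [hH, hz] using hc
    · simpa [hz] using hc
  have hUsub : U ⊆ (A ∩ H) ∩ (A ∩ {z | -z ∈ H}) := by
    rintro z ⟨⟨h1, h2⟩, h3, h4⟩
    have hzA : z ∈ A := ⟨h1, by simpa using h2.le⟩
    refine ⟨⟨hzA, h3⟩, hzA, ?_⟩
    change inner ℝ p (-z) < c
    rw [inner_neg_right]
    have : -c < inner ℝ p z := h4
    linarith
  have hpos : 0 < volume.real ((A ∩ H) ∩ (A ∩ {z | -z ∈ H})) :=
    ENNReal.toReal_pos ((hUo.measure_pos volume hUn).trans_le (measure_mono hUsub)).ne'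
      (measure_ne_top_of_subset inter_subset_left (hfin _))
  linarith

end HalfMeasure

/-! ### Points with vanishing Hessian. -/

theorem eventually_half_lt_volume_sublevel_of_degenerate {d : ℕ} (hd : 2 ≤ d) {κ : ℝ → ℝ}
    (hκ : ∀ r : ℝ, 0 < r → κ r ∈ Ico (0 : ℝ) 1)
    {φ : EuclideanSpace ℝ (Fin d) → ℝ} (hφ : ContDiff ℝ ∞ φ) {x : EuclideanSpace ℝ (Fin d)}
    (hx : hessian φ x = 0) {m : ℝ} (hm : 0 < m) :
    ∀ᶠ q : ℝ × EuclideanSpace ℝ (Fin d) in 𝓝[>] 0 ×ˢ 𝓝 x,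
      volume.real (annulus (κ q.1) q.1 q.2) <
        2 * volume.real (annulus (κ q.1) q.1 q.2 ∩ {y | φ y < φ q.2 + m * q.1 ^ 2}) := by
  filter_upwards [eventually_taylor_bound hφ (M := m) (by simpa [hx] using hm),
    Eventually.prod_inl (p := fun r => 0 < r) self_mem_nhdsWithin _] with ⟨r, y⟩ hT hr
  simp only at hr hT ⊢
  -- Taylor leaves `(m/2) r²` of the allowed `m r²`. Divided by `r`, this is the shift `r m / 2` of
  -- the half-space.
  refine half_lt_of_similarity _ y hr (LinearIsometryEquiv.refl ℝ _) _ ?_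
  refine (volume_annulus_lt_two_mul_halfspace hd (hκ r hr) (gradient φ y)
    (c := r * m / 2) (by positivity)).trans_le ?_
  refine mul_le_mul_of_nonneg_left (measureReal_mono ?_ ?_) two_pos.le
  · rintro z ⟨hz, hzp⟩
    refine ⟨hz, ?_⟩
    have hzp : inner ℝ (gradient φ y) z < r * m / 2 := hzp
    have hz1 : ‖z‖ < 1 := by simpa using hz.1
    change φ (y + r • z) < φ y + m * r ^ 2
    have := (abs_le.1 (hT z hz1.le)).2
    linarith [mul_lt_mul_of_pos_left hzp hr]
  · exact measure_ne_top_of_subset inter_subset_left (volume_annulus_ne_top _ _ _)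

/-! ### Polar coordinates on the annulus. -/

section Polar

lemma integral_polar {E : Type*} [NormedAddCommGroup E] [NormedSpace ℝ E] [MeasurableSpace E]
    [BorelSpace E] [FiniteDimensional ℝ E] [Nontrivial E] (μ : Measure E) [μ.IsAddHaarMeasure]
    {F : E → ℝ} (hF : Integrable F μ) :
    ∫ x, F x ∂μ = ∫ τ in Ioi (0 : ℝ), τ ^ (Module.finrank ℝ E - 1) *
      ∫ θ : Metric.sphere (0 : E) 1, F (τ • (θ : E)) ∂μ.toSphere := by
  set G : Metric.sphere (0 : E) 1 × Ioi (0 : ℝ) → ℝ := fun p => F ((p.2 : ℝ) • (p.1 : E)) with hG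
  have hGx : ∀ x : ({(0)}ᶜ : Set E), G (homeomorphUnitSphereProd E x) = F x := by
    intro x
    have := congrArg Subtype.val ((homeomorphUnitSphereProd E).symm_apply_apply x)
    rw [homeomorphUnitSphereProd_symm_apply_coe] at this
    simp only [hG, this]
  have hmp := μ.measurePreserving_homeomorphUnitSphereProd
  have hemb := (homeomorphUnitSphereProd E).measurableEmbedding
  have hGi : Integrable G (μ.toSphere.prod (.volumeIoiPow (Module.finrank ℝ E - 1))) := by
    rw [← hmp.integrable_comp_emb hemb]
    have : G ∘ homeomorphUnitSphereProd E = F ∘ Subtype.val := funext hGx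
    rw [this, ← integrableOn_iff_comap_subtypeVal (measurableSet_singleton _).compl]
    exact hF.integrableOn
  calc ∫ x, F x ∂μ = ∫ x : ({(0)}ᶜ : Set E), F x.1 ∂(μ.comap (↑)) := by
        rw [integral_subtype_comap (measurableSet_singleton _).compl F,
          restrict_compl_singleton]
    _ = ∫ p, G p ∂μ.toSphere.prod (.volumeIoiPow (Module.finrank ℝ E - 1)) := by
        rw [← hmp.integral_comp hemb]
        simp only [hGx]
    _ = ∫ τ : Ioi (0 : ℝ), ∫ θ, G (θ, τ) ∂μ.toSphere ∂(.volumeIoiPow (Module.finrank ℝ E - 1)) :=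
        integral_prod_symm _ hGi
    _ = _ := by
        simp only [Measure.volumeIoiPow, ENNReal.ofReal]
        rw [integral_withDensity_eq_integral_smul,
          integral_subtype_comap measurableSet_Ioi fun a ↦
            Real.toNNReal (a ^ (Module.finrank ℝ E - 1)) •
              ∫ θ : Metric.sphere (0 : E) 1, F (a • (θ : E)) ∂μ.toSphere]
        · refine setIntegral_congr_fun measurableSet_Ioi fun a ha => ?_
          simp only [NNReal.smul_def, Real.coe_toNNReal _ (pow_nonneg (le_of_lt ha) _), smul_eq_mul]
        · exact (measurable_subtype_coe.pow_const _).real_toNNReal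

/-- Extending `f` radially to the ball costs the radial integral of `τ^(n-1)`, which is `1/n`.
Directions are thereby averaged with Lebesgue measure, which Fubini can slice. -/
lemma integral_toSphere_eq {E : Type*} [NormedAddCommGroup E] [NormedSpace ℝ E] [MeasurableSpace E]
    [BorelSpace E] [FiniteDimensional ℝ E] [Nontrivial E] (μ : Measure E) [μ.IsAddHaarMeasure]
    {f : E → ℝ} (hf : Measurable f) {C : ℝ} (hC : ∀ x, |f x| ≤ C) :
    ∫ θ : Metric.sphere (0 : E) 1, f θ ∂μ.toSphere =
      Module.finrank ℝ E * ∫ z in Metric.ball (0 : E) 1, f (‖z‖⁻¹ • z) ∂μ := by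
  have hm : Measurable fun z : E => f (‖z‖⁻¹ • z) :=
    hf.comp (measurable_norm.inv.smul measurable_id)
  have hint : IntegrableOn (fun z : E => f (‖z‖⁻¹ • z)) (Metric.ball 0 1) μ :=
    Measure.integrableOn_of_bounded (M := C) measure_ball_lt_top.ne hm.aestronglyMeasurable
      (ae_of_all _ fun z => hC _)
  have h1 := integral_polar μ ((integrable_indicator_iff measurableSet_ball).2 hint)
  rw [integral_indicator measurableSet_ball] at h1
  have h2 : ∀ τ ∈ Ioi (0 : ℝ), τ ^ (Module.finrank ℝ E - 1) * ∫ θ : Metric.sphere (0 : E) 1,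
      (Metric.ball (0 : E) 1).indicator (fun z : E => f (‖z‖⁻¹ • z)) (τ • (θ : E)) ∂μ.toSphere =
      (Ioo (0 : ℝ) 1).indicator (fun τ => τ ^ (Module.finrank ℝ E - 1) *
        ∫ θ : Metric.sphere (0 : E) 1, f θ ∂μ.toSphere) τ := by
    intro τ hτ
    have hτ' : 0 < τ := hτ
    have hn : ∀ θ : Metric.sphere (0 : E) 1, ‖τ • (θ : E)‖ = τ := fun θ => by
      rw [norm_smul, Real.norm_of_nonneg hτ'.le, norm_eq_of_mem_sphere, mul_one]
    by_cases h : τ < 1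
    · rw [indicator_of_mem (show τ ∈ Ioo (0 : ℝ) 1 from ⟨hτ, h⟩)]
      congr 1
      refine integral_congr_ae (ae_of_all _ fun θ => ?_)
      simp only
      rw [indicator_of_mem (by simpa [hn θ] using h), hn, smul_smul, inv_mul_cancel₀ hτ'.ne', one_smul]
    · rw [indicator_of_notMem (fun h' => h h'.2)]
      have : ∀ θ : Metric.sphere (0 : E) 1, (Metric.ball (0 : E) 1).indicator
          (fun z : E => f (‖z‖⁻¹ • z)) (τ • (θ : E)) = 0 := fun θ =>
        indicator_of_notMem (by simpa [hn θ] using h) _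
      simp [this]
  rw [setIntegral_congr_fun measurableSet_Ioi h2, setIntegral_indicator measurableSet_Ioo,
    inter_eq_right.2 Ioo_subset_Ioi_self, integral_mul_const, ← integral_Ioc_eq_integral_Ioo,
    ← intervalIntegral.integral_of_le zero_le_one, integral_pow] at h1
  have hpos : 0 < Module.finrank ℝ E := Module.finrank_pos
  have hne : (Module.finrank ℝ E : ℝ) ≠ 0 := by positivity
  rw [h1, Nat.sub_add_cancel hpos, Nat.cast_pred hpos]
  simp [hpos.ne']

lemma setIntegral_annulus_eq {d : ℕ} (hd : 0 < d) {κ : ℝ} (hκ : 0 ≤ κ)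
    {f : EuclideanSpace ℝ (Fin d) → ℝ} (hf : Measurable f) {C : ℝ} (hC : ∀ x, |f x| ≤ C) :
    ∫ z in annulus κ 1 (0 : EuclideanSpace ℝ (Fin d)), f z =
      d * ∫ ρ in Ico κ 1, ρ ^ (d - 1) *
        ∫ z in Metric.ball (0 : EuclideanSpace ℝ (Fin d)) 1, f (ρ • ‖z‖⁻¹ • z) := by
  have : NeZero d := ⟨hd.ne'⟩
  have hint : IntegrableOn f (annulus κ 1 (0 : EuclideanSpace ℝ (Fin d))) :=
    Measure.integrableOn_of_bounded (M := C) (volume_annulus_ne_top _ _ _) hf.aestronglyMeasurable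
      (ae_of_all _ fun z => hC _)
  have hmeas := measurableSet_annulus κ 1 (0 : EuclideanSpace ℝ (Fin d))
  rw [← integral_indicator hmeas, integral_polar volume ((integrable_indicator_iff hmeas).2 hint),
    finrank_euclideanSpace_fin, ← integral_const_mul]
  have h2 : ∀ τ ∈ Ioi (0 : ℝ), τ ^ (d - 1) * ∫ θ : Metric.sphere (0 : EuclideanSpace ℝ (Fin d)) 1,
      (annulus κ 1 (0 : EuclideanSpace ℝ (Fin d))).indicator f (τ • (θ : EuclideanSpace ℝ (Fin d)))
        ∂(volume : Measure (EuclideanSpace ℝ (Fin d))).toSphere =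
      (Ico κ 1).indicator (fun τ => d * (τ ^ (d - 1) *
        ∫ z in Metric.ball (0 : EuclideanSpace ℝ (Fin d)) 1, f (τ • ‖z‖⁻¹ • z))) τ := by
    intro τ hτ
    have hτ' : 0 < τ := hτ
    have hn : ∀ θ : Metric.sphere (0 : EuclideanSpace ℝ (Fin d)) 1,
        ‖τ • (θ : EuclideanSpace ℝ (Fin d))‖ = τ := fun θ => by
      rw [norm_smul, Real.norm_of_nonneg hτ'.le, norm_eq_of_mem_sphere, mul_one]
    have hmem : ∀ θ : Metric.sphere (0 : EuclideanSpace ℝ (Fin d)) 1,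
        τ • (θ : EuclideanSpace ℝ (Fin d)) ∈ annulus κ 1 (0 : EuclideanSpace ℝ (Fin d)) ↔ τ ∈ Ico κ 1 := by
      intro θ
      simp only [annulus, Set.mem_sdiff, Metric.mem_ball, dist_zero_right, hn, mul_one, not_lt, mem_Ico]
      exact and_comm
    by_cases h : τ ∈ Ico κ 1
    · rw [indicator_of_mem h, mul_left_comm]
      congr 1
      have := integral_toSphere_eq (volume : Measure (EuclideanSpace ℝ (Fin d)))
        (hf.comp (measurable_const_smul τ)) (C := C) (fun x => hC _)
      simp only [finrank_euclideanSpace_fin, Function.comp_apply] at this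
      rw [← this]
      refine integral_congr_ae (ae_of_all _ fun θ => ?_)
      simp only
      rw [indicator_of_mem ((hmem θ).2 h)]
    · rw [indicator_of_notMem h]
      have : ∀ θ : Metric.sphere (0 : EuclideanSpace ℝ (Fin d)) 1,
          (annulus κ 1 (0 : EuclideanSpace ℝ (Fin d))).indicator f
            (τ • (θ : EuclideanSpace ℝ (Fin d))) = 0 := fun θ =>
        indicator_of_notMem (fun h' => h ((hmem θ).1 h')) _
      simp [this]
  rw [setIntegral_congr_fun measurableSet_Ioi h2, setIntegral_indicator measurableSet_Ico]
  refine setIntegral_congr_set ?_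
  -- When `κ = 0` the radius `0` lies in `Ico κ 1` but is omitted by polar coordinates; it is a null
  -- set.
  have : (Ioi (0 : ℝ) ∩ Ico κ 1 : Set ℝ) =ᵐ[volume] (Ici 0 ∩ Ico κ 1 : Set ℝ) :=
    Ioi_ae_eq_Ici.inter (ae_eq_refl _)
  rwa [inter_eq_right.2 (fun t (ht : t ∈ Ico κ 1) => mem_Ici.2 (hκ.trans ht.1))] at this

end Polar

/-! ### Slicing along the first coordinate axis. -/

section Slicing

/-- The point of `ℝⁿ⁺¹` with first coordinate `s` and remaining coordinates `w`. -/
noncomputable def euclideanCons {n : ℕ} (s : ℝ) (w : EuclideanSpace ℝ (Fin n)) :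
    EuclideanSpace ℝ (Fin (n + 1)) :=
  WithLp.toLp 2 (Fin.cons s w.ofLp)

variable {n : ℕ}

@[simp] lemma euclideanCons_zero (s : ℝ) (w : EuclideanSpace ℝ (Fin n)) :
    euclideanCons s w 0 = s := rfl

@[simp] lemma euclideanCons_succ (s : ℝ) (w : EuclideanSpace ℝ (Fin n)) (i : Fin n) :
    euclideanCons s w i.succ = w i := rfl

lemma norm_euclideanCons_sq (s : ℝ) (w : EuclideanSpace ℝ (Fin n)) :
    ‖euclideanCons s w‖ ^ 2 = s ^ 2 + ‖w‖ ^ 2 := by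
  simp [EuclideanSpace.norm_sq_eq, Fin.sum_univ_succ]

@[simp] lemma norm_euclideanCons_zero (w : EuclideanSpace ℝ (Fin n)) :
    ‖euclideanCons 0 w‖ = ‖w‖ := by
  have := norm_euclideanCons_sq 0 w
  rw [zero_pow two_ne_zero, zero_add] at this
  exact (sq_eq_sq₀ (norm_nonneg _) (norm_nonneg _)).1 this

lemma abs_le_norm_euclideanCons (s : ℝ) (w : EuclideanSpace ℝ (Fin n)) :
    |s| ≤ ‖euclideanCons s w‖ := by
  refine abs_le_of_sq_le_sq ?_ (norm_nonneg _)
  rw [norm_euclideanCons_sq]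
  linarith [sq_nonneg ‖w‖]

lemma norm_le_norm_euclideanCons (s : ℝ) (w : EuclideanSpace ℝ (Fin n)) :
    ‖w‖ ≤ ‖euclideanCons s w‖ := by
  refine le_of_sq_le_sq ?_ (norm_nonneg _)
  rw [norm_euclideanCons_sq]
  linarith [sq_nonneg s]

lemma continuous_euclideanCons :
    Continuous fun p : ℝ × EuclideanSpace ℝ (Fin n) => euclideanCons p.1 p.2 := by
  refine (PiLp.continuous_toLp 2 _).comp (continuous_pi fun i => ?_)
  refine Fin.cases ?_ (fun j => ?_) i
  · exact continuous_fst
  · simp only [Fin.cons_succ]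
    fun_prop

lemma measurePreserving_euclideanCons :
    MeasurePreserving fun p : ℝ × EuclideanSpace ℝ (Fin n) => euclideanCons p.1 p.2 := by
  have h1 : MeasurePreserving (Prod.map id (@WithLp.ofLp 2 (Fin n → ℝ)) :
      ℝ × EuclideanSpace ℝ (Fin n) → ℝ × (Fin n → ℝ)) :=
    (MeasurePreserving.id volume).prod (PiLp.volume_preserving_ofLp (Fin n))
  have h2 := (volume_preserving_piFinSuccAbove (fun _ : Fin (n + 1) => ℝ) 0).symm
  have h3 := PiLp.volume_preserving_toLp (Fin (n + 1))
  convert h3.comp (h2.comp h1) using 1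
  funext p
  simp [euclideanCons, MeasurableEquiv.piFinSuccAbove, Fin.insertNthEquiv]

lemma measurableEmbedding_euclideanCons :
    MeasurableEmbedding fun p : ℝ × EuclideanSpace ℝ (Fin n) => euclideanCons p.1 p.2 := by
  refine continuous_euclideanCons.measurableEmbedding fun p q h => ?_
  have h0 := congrArg (fun z : EuclideanSpace ℝ (Fin (n + 1)) => z 0) h
  have hs : ∀ i : Fin n, p.2 i = q.2 i := fun i =>
    congrArg (fun z : EuclideanSpace ℝ (Fin (n + 1)) => z i.succ) h
  exact Prod.ext h0 (by ext i; exact hs i)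

/-- Fubini's theorem along the first coordinate axis, with this axis rescaled by `c`. -/
lemma integral_eq_integral_slices {G : EuclideanSpace ℝ (Fin (n + 1)) → ℝ} (hG : Integrable G)
    {c : ℝ} (hc : 0 < c) :
    ∫ z, G z = c * ∫ w, ∫ s, G (euclideanCons (c * s) w) := by
  have hi := (measurePreserving_euclideanCons.integrable_comp_emb
    measurableEmbedding_euclideanCons).2 hG
  rw [← measurePreserving_euclideanCons.integral_comp measurableEmbedding_euclideanCons,
    Measure.volume_eq_prod, integral_prod_symm _ (by exact hi), ← integral_const_mul]
  refine integral_congr_ae (ae_of_all _ fun w => ?_)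
  simp only
  rw [Measure.integral_comp_mul_left (fun s => G (euclideanCons s w)) c, abs_inv, abs_of_pos hc,
    smul_eq_mul, ← mul_assoc, mul_inv_cancel₀ hc.ne', one_mul]

end Slicing

/-! ### Blow-up of the layer around the hyperplane. -/

section Rescaling

/-- Integrand over `(u, w, s)` of the integral of `f` over the unit annulus: the radius is
`ρ = κ + (1 - κ) u`, and the direction is that of the point `(r s / ρ, w)` of the unit ball. -/
noncomputable def rescaledIntegrand (k : ℕ) (κ r : ℝ) (f : EuclideanSpace ℝ (Fin (k + 2)) → ℝ)
    (p : (ℝ × EuclideanSpace ℝ (Fin (k + 1))) × ℝ) : ℝ :=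
  if p.1.1 ∈ Ioo (0 : ℝ) 1 ∧ ‖euclideanCons (r / (κ + (1 - κ) * p.1.1) * p.2) p.1.2‖ < 1 then
    (κ + (1 - κ) * p.1.1) ^ k * f ((κ + (1 - κ) * p.1.1) •
      ‖euclideanCons (r / (κ + (1 - κ) * p.1.1) * p.2) p.1.2‖⁻¹ •
        euclideanCons (r / (κ + (1 - κ) * p.1.1) * p.2) p.1.2)
  else 0

variable {k : ℕ} {κ r : ℝ} {f : EuclideanSpace ℝ (Fin (k + 2)) → ℝ}

lemma radius_pos (hκ : κ ∈ Ico (0 : ℝ) 1) {u : ℝ} (hu : u ∈ Ioo (0 : ℝ) 1) :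
    0 < κ + (1 - κ) * u :=
  add_pos_of_nonneg_of_pos hκ.1 (mul_pos (sub_pos.2 hκ.2) hu.1)

lemma radius_le_one (hκ : κ ≤ 1) {u : ℝ} (hu : u ≤ 1) : κ + (1 - κ) * u ≤ 1 := by
  nlinarith

lemma measurable_rescaledIntegrand (hf : Measurable f) :
    Measurable (rescaledIntegrand k κ r f) := by
  have hρ : Measurable fun p : (ℝ × EuclideanSpace ℝ (Fin (k + 1))) × ℝ => κ + (1 - κ) * p.1.1 := by
    fun_prop
  have hz : Measurable fun p : (ℝ × EuclideanSpace ℝ (Fin (k + 1))) × ℝ =>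
      euclideanCons (r / (κ + (1 - κ) * p.1.1) * p.2) p.1.2 :=
    continuous_euclideanCons.measurable.comp
      (((hρ.const_div r).mul measurable_snd).prodMk (measurable_snd.comp measurable_fst))
  refine Measurable.ite ?_ ?_ measurable_const
  · exact (measurableSet_Ioo.preimage (measurable_fst.comp measurable_fst)).inter
      (measurableSet_lt hz.norm measurable_const)
  · exact (hρ.pow_const k).mul (hf.comp (hρ.smul (hz.norm.inv.smul hz)))

lemma abs_rescaledIntegrand_le (hκ : κ ∈ Ico (0 : ℝ) 1) {C : ℝ} (hC : ∀ z, |f z| ≤ C)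
    (p : (ℝ × EuclideanSpace ℝ (Fin (k + 1))) × ℝ) : |rescaledIntegrand k κ r f p| ≤ C := by
  unfold rescaledIntegrand
  have hC0 : 0 ≤ C := (abs_nonneg _).trans (hC 0)
  split_ifs with h
  · have hp := radius_pos hκ h.1
    rw [abs_mul, abs_of_nonneg (by positivity)]
    calc _ ≤ 1 * C := by
          gcongr
          · exact pow_le_one₀ hp.le (radius_le_one hκ.2.le h.1.2.le)
          · exact hC _
      _ = C := one_mul C
  · simpa using hC0

lemma integrable_rescaledIntegrand (hκ : κ ∈ Ico (0 : ℝ) 1) (hr : 0 < r) (hf : Measurable f)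
    {C : ℝ} (hC : ∀ z, |f z| ≤ C) : Integrable (rescaledIntegrand k κ r f) := by
  -- Membership in the unit ball forces `r |s| / ρ < 1`, and `ρ ≤ 1` then gives `|s| < 1 / r`.
  set S : Set ((ℝ × EuclideanSpace ℝ (Fin (k + 1))) × ℝ) :=
    (Ioo 0 1 ×ˢ Metric.ball 0 1) ×ˢ Ioo (-(1 / r)) (1 / r) with hS
  have hSm : MeasurableSet S :=
    (measurableSet_Ioo.prod measurableSet_ball).prod measurableSet_Ioo
  have hSf : volume S ≠ ⊤ := by
    rw [hS, Measure.volume_eq_prod, Measure.prod_prod, Measure.volume_eq_prod, Measure.prod_prod]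
    exact ENNReal.mul_ne_top (ENNReal.mul_ne_top (by simp) measure_ball_lt_top.ne) (by simp)
  have hb : Integrable (S.indicator fun _ => C) :=
    (integrable_indicator_iff hSm).2 (integrableOn_const hSf)
  refine hb.mono' (measurable_rescaledIntegrand hf).aestronglyMeasurable (ae_of_all _ fun p => ?_)
  by_cases hp : p ∈ S
  · rw [indicator_of_mem hp]
    exact abs_rescaledIntegrand_le hκ hC p
  · rw [indicator_of_notMem hp]
    unfold rescaledIntegrand
    rw [if_neg, norm_zero]
    rintro ⟨hu, hz⟩
    refine hp ⟨⟨hu, ?_⟩, ?_⟩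
    · simpa using (norm_le_norm_euclideanCons _ _).trans_lt hz
    · have h1 := (abs_le_norm_euclideanCons _ _).trans_lt hz
      have hρ := radius_pos hκ hu
      have hρ1 := radius_le_one hκ.2.le hu.2.le
      rw [abs_mul, abs_of_pos (by positivity), div_mul_eq_mul_div, div_lt_one hρ] at h1
      rw [mem_Ioo, ← abs_lt, lt_div_iff₀ hr]
      linarith

/-- The substitution `ρ = κ + (1 - κ) u` yields `1 - κ`. Stretching the first axis by `r / ρ` yields
`r` and lowers the polar weight from `ρ^(k+1)` to `ρ^k`. -/
lemma setIntegral_annulus_eq_rescaled (hκ : κ ∈ Ico (0 : ℝ) 1) (hr : 0 < r) (hf : Measurable f)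
    {C : ℝ} (hC : ∀ z, |f z| ≤ C) :
    ∫ z in annulus κ 1 (0 : EuclideanSpace ℝ (Fin (k + 2))), f z =
      (k + 2) * (1 - κ) * r * ∫ p, rescaledIntegrand k κ r f p := by
  have hH := integrable_rescaledIntegrand hκ hr hf hC
  have h1 : ∀ u ∈ Ioo (0 : ℝ) 1,
      (κ + (1 - κ) * u) ^ (k + 1) * ∫ z in Metric.ball (0 : EuclideanSpace ℝ (Fin (k + 2))) 1,
        f ((κ + (1 - κ) * u) • ‖z‖⁻¹ • z) = r * ∫ w, ∫ s, rescaledIntegrand k κ r f ((u, w), s) := by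
    intro u hu
    have hρ := radius_pos hκ hu
    have hint : IntegrableOn (fun z : EuclideanSpace ℝ (Fin (k + 2)) =>
        f ((κ + (1 - κ) * u) • ‖z‖⁻¹ • z)) (Metric.ball 0 1) :=
      Measure.integrableOn_of_bounded (M := C) measure_ball_lt_top.ne
        (hf.comp ((measurable_norm.inv.smul measurable_id).const_smul
          (κ + (1 - κ) * u))).aestronglyMeasurable
        (ae_of_all _ fun z => hC _)
    rw [← integral_indicator measurableSet_ball,
      integral_eq_integral_slices ((integrable_indicator_iff measurableSet_ball).2 hint)
        (div_pos hr hρ)]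
    have h2 : ∀ w s, rescaledIntegrand k κ r f ((u, w), s) = (κ + (1 - κ) * u) ^ k *
        (Metric.ball (0 : EuclideanSpace ℝ (Fin (k + 2))) 1).indicator
          (fun z => f ((κ + (1 - κ) * u) • ‖z‖⁻¹ • z))
          (euclideanCons (r / (κ + (1 - κ) * u) * s) w) := by
      intro w s
      by_cases hz : ‖euclideanCons (r / (κ + (1 - κ) * u) * s) w‖ < 1
      · rw [indicator_of_mem (by simpa using hz), rescaledIntegrand, if_pos ⟨hu, hz⟩]
      · rw [indicator_of_notMem (by simpa using hz), rescaledIntegrand, if_neg (fun h => hz h.2),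
          mul_zero]
    simp only [h2, integral_const_mul]
    rw [← mul_assoc, ← mul_assoc, mul_div_assoc', pow_succ, mul_right_comm, mul_assoc _ r]
    congr 1
    field_simp
  rw [setIntegral_annulus_eq (by omega) hκ.1 hf hC, integral_Ico_eq_integral_Ioo,
    ← integral_Ioc_eq_integral_Ioo, ← intervalIntegral.integral_of_le hκ.2.le]
  have h3 := intervalIntegral.mul_integral_comp_add_mul (a := 0) (b := 1)
    (f := fun ρ : ℝ => ρ ^ (k + 1) * ∫ z in Metric.ball (0 : EuclideanSpace ℝ (Fin (k + 2))) 1,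
        f (ρ • ‖z‖⁻¹ • z)) (c := 1 - κ) (d := κ)
  rw [mul_zero, add_zero, mul_one, add_sub_cancel] at h3
  rw [show k + 2 - 1 = k + 1 from rfl, ← h3, intervalIntegral.integral_of_le zero_le_one,
    integral_Ioc_eq_integral_Ioo, setIntegral_congr_fun measurableSet_Ioo h1, integral_const_mul,
    Measure.volume_eq_prod, integral_prod _ (by exact hH), Measure.volume_eq_prod,
    integral_prod _ (by exact hH.integral_prod_left), ← integral_indicator measurableSet_Ioo]
  have h4 : ∀ u, (Ioo (0 : ℝ) 1).indicator
      (fun u => ∫ w, ∫ s, rescaledIntegrand k κ r f ((u, w), s)) u =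
      ∫ w, ∫ s, rescaledIntegrand k κ r f ((u, w), s) := by
    intro u
    by_cases hu : u ∈ Ioo (0 : ℝ) 1
    · rw [indicator_of_mem hu]
    · rw [indicator_of_notMem hu]
      have : ∀ w s, rescaledIntegrand k κ r f ((u, w), s) = 0 := fun w s =>
        if_neg fun h => hu h.1
      simp [this]
  simp only [h4]
  push_cast
  ring

end Rescaling

/-! ### Second moments of radial weights. -/

section Moments

variable {n : ℕ}

lemma integral_comp_linearIsometryEquiv {E : Type*} [NormedAddCommGroup E] [InnerProductSpace ℝ E]
    [FiniteDimensional ℝ E] [MeasurableSpace E] [BorelSpace E] (e : E ≃ₗᵢ[ℝ] E) (f : E → ℝ) :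
    ∫ x, f (e x) = ∫ x, f x :=
  e.measurePreserving.integral_comp e.toHomeomorph.measurableEmbedding f

/-- Flipping the sign of coordinate `i` is an isometry that negates the integrand. -/
lemma integral_radial_mul_coord_of_ne (g : ℝ → ℝ) {i j : Fin n} (hij : i ≠ j) :
    ∫ w : EuclideanSpace ℝ (Fin n), g ‖w‖ * (w i * w j) = 0 := by
  let e : EuclideanSpace ℝ (Fin n) ≃ₗᵢ[ℝ] EuclideanSpace ℝ (Fin n) :=
    LinearIsometryEquiv.piLpCongrRight 2 fun l =>
      if l = i then LinearIsometryEquiv.neg ℝ else LinearIsometryEquiv.refl ℝ ℝ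
  have hi : ∀ w, e w i = -w i := fun w => by simp [e]
  have hj : ∀ w, e w j = w j := fun w => by simp [e, hij.symm]
  have h := integral_comp_linearIsometryEquiv e fun w => g ‖w‖ * (w i * w j)
  simp only [LinearIsometryEquiv.norm_map, hi, hj, neg_mul, mul_neg, integral_neg] at h
  linarith

lemma integral_radial_mul_coord_sq_eq (g : ℝ → ℝ) (i j : Fin n) :
    ∫ w : EuclideanSpace ℝ (Fin n), g ‖w‖ * (w i * w i) =
      ∫ w : EuclideanSpace ℝ (Fin n), g ‖w‖ * (w j * w j) := by
  let e : EuclideanSpace ℝ (Fin n) ≃ₗᵢ[ℝ] EuclideanSpace ℝ (Fin n) :=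
    LinearIsometryEquiv.piLpCongrLeft 2 ℝ ℝ (Equiv.swap i j)
  have hi : ∀ w, e w i = w j := fun w => by
    simp [e, LinearIsometryEquiv.piLpCongrLeft_apply, Equiv.piCongrLeft'_apply]
  have h := integral_comp_linearIsometryEquiv e fun w => g ‖w‖ * (w i * w i)
  simp only [LinearIsometryEquiv.norm_map, hi] at h
  exact h.symm

lemma mul_bilinForm_eq_sum (B : LinearMap.BilinForm ℝ (EuclideanSpace ℝ (Fin n))) (c : ℝ)
    (w : EuclideanSpace ℝ (Fin n)) :
    c * B w w = ∑ i, ∑ j, B (EuclideanSpace.basisFun (Fin n) ℝ i)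
      (EuclideanSpace.basisFun (Fin n) ℝ j) * (c * (w i * w j)) := by
  set b := EuclideanSpace.basisFun (Fin n) ℝ with hb
  have hw : w = ∑ i, w i • b i := by
    conv_lhs => rw [← b.sum_repr w]
    simp [hb]
  have : B w w = ∑ i, ∑ j, w i * (w j * B (b i) (b j)) := by
    conv_lhs => rw [hw]
    simp only [map_sum, map_smul, LinearMap.sum_apply, LinearMap.smul_apply, smul_eq_mul,
      Finset.mul_sum]
    rw [Finset.sum_comm]
    exact Finset.sum_congr rfl fun i _ => Finset.sum_congr rfl fun j _ => by ring
  rw [this, Finset.mul_sum]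
  refine Finset.sum_congr rfl fun i _ => ?_
  rw [Finset.mul_sum]
  exact Finset.sum_congr rfl fun j _ => by ring

lemma integrable_radial_mul_bilinForm {g : ℝ → ℝ}
    (hg : ∀ i j : Fin n, Integrable fun w : EuclideanSpace ℝ (Fin n) => g ‖w‖ * (w i * w j))
    (B : LinearMap.BilinForm ℝ (EuclideanSpace ℝ (Fin n))) :
    Integrable fun w => g ‖w‖ * B w w := by
  simp only [mul_bilinForm_eq_sum B]
  exact integrable_finsetSum _ fun i _ => integrable_finsetSum _ fun j _ => (hg i j).const_mul _

/-- Sign flips and coordinate swaps make the second-moment matrix scalar, so only the trace of `B`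
survives. -/
lemma integral_radial_mul_bilinForm [NeZero n] (g : ℝ → ℝ)
    (hg : ∀ i j : Fin n, Integrable fun w : EuclideanSpace ℝ (Fin n) => g ‖w‖ * (w i * w j))
    (B : LinearMap.BilinForm ℝ (EuclideanSpace ℝ (Fin n))) :
    ∫ w, g ‖w‖ * B w w = (∑ i, B (EuclideanSpace.basisFun (Fin n) ℝ i)
      (EuclideanSpace.basisFun (Fin n) ℝ i)) / n *
        ∫ w : EuclideanSpace ℝ (Fin n), g ‖w‖ * ‖w‖ ^ 2 := by
  set b := EuclideanSpace.basisFun (Fin n) ℝ with hb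
  have hdiag : ∀ i, ∫ w : EuclideanSpace ℝ (Fin n), g ‖w‖ * (w i * w i) =
      (∫ w : EuclideanSpace ℝ (Fin n), g ‖w‖ * ‖w‖ ^ 2) / n := by
    intro i
    have hsq : ∀ w : EuclideanSpace ℝ (Fin n), g ‖w‖ * ‖w‖ ^ 2 = ∑ j, g ‖w‖ * (w j * w j) := by
      intro w
      rw [EuclideanSpace.norm_sq_eq, Finset.mul_sum]
      exact Finset.sum_congr rfl fun j _ => by rw [Real.norm_eq_abs, sq_abs, sq]
    simp only [hsq]
    rw [integral_finsetSum _ fun j _ => hg j j,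
      Finset.sum_congr rfl fun j _ => integral_radial_mul_coord_sq_eq g j i]
    simp [NeZero.ne n]
  simp only [mul_bilinForm_eq_sum B]
  rw [integral_finsetSum _ fun i _ => integrable_finsetSum _ fun j _ => (hg i j).const_mul _,
    Finset.sum_div, Finset.sum_mul]
  refine Finset.sum_congr rfl fun i _ => ?_
  rw [integral_finsetSum _ fun j _ => (hg i j).const_mul _, Finset.sum_eq_single i]
  · rw [integral_const_mul, hdiag]
    ring
  · intro j _ hj
    rw [integral_const_mul, integral_radial_mul_coord_of_ne g hj.symm, mul_zero]
  · simp

end Moments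

/-! ### Isometries adapted to the gradient. -/

section Isometries

lemma tendsto_reflection_orthogonal_singleton {E ι : Type*} [NormedAddCommGroup E]
    [InnerProductSpace ℝ E] {l : Filter ι} {u v : ι → E} {u₀ v₀ : E} (hu : Tendsto u l (𝓝 u₀))
    (hv : Tendsto v l (𝓝 v₀)) (h0 : u₀ ≠ 0) :
    Tendsto (fun i => (ℝ ∙ u i)ᗮ.reflection (v i)) l (𝓝 ((ℝ ∙ u₀)ᗮ.reflection v₀)) := by
  simp only [Submodule.reflection_orthogonal_apply, Submodule.reflection_singleton_apply]
  refine ((Tendsto.const_smul ?_ 2).sub hv).neg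
  refine Tendsto.smul ?_ hu
  exact (hu.inner hv).div (by simpa using hu.norm.pow 2) (by simpa using h0)

/-- A family of isometries that carry a fixed unit vector `b` to a unit vector `e'`, continuous
at a given `e`. -/
lemma exists_isometry_family {E : Type*} [NormedAddCommGroup E] [InnerProductSpace ℝ E]
    (b e : E) (hb : ‖b‖ = 1) :
    ∃ O : E → E ≃ₗᵢ[ℝ] E, (∀ e', ‖e'‖ = 1 → O e' b = e') ∧
      ∀ {ι : Type} {l : Filter ι} {u v : ι → E} {v₀ : E}, Tendsto u l (𝓝 e) →
        Tendsto v l (𝓝 v₀) → Tendsto (fun i => O (u i) (v i)) l (𝓝 (O e v₀)) := by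
  -- The reflection exchanging `e'` and `b` is discontinuous at `e' = b`. There the negative of the
  -- reflection exchanging `e'` and `-b` serves instead.
  by_cases h : e = b
  · refine ⟨fun e' => (ℝ ∙ (e' - -b))ᗮ.reflection.trans (LinearIsometryEquiv.neg ℝ),
      fun e' he' => ?_, fun hu hv => ?_⟩
    · have := Submodule.reflection_sub (F := E) (v := e') (w := -b) (by rw [he', norm_neg, hb])
      have h2 := congrArg (ℝ ∙ (e' - -b))ᗮ.reflection this
      rw [Submodule.reflection_reflection, map_neg] at h2
      simpa using h2.symm
    · have : e - -b ≠ 0 := by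
        rw [h, sub_neg_eq_add, ← two_smul ℝ]
        have : b ≠ 0 := by
          rintro rfl
          simp at hb
        simpa using this
      simpa using (tendsto_reflection_orthogonal_singleton (hu.sub_const (-b)) hv this).neg
  · refine ⟨fun e' => (ℝ ∙ (e' - b))ᗮ.reflection, fun e' he' => ?_, fun hu hv => ?_⟩
    · have := Submodule.reflection_sub (F := E) (v := e') (w := b) (by rw [he', hb])
      have h2 := congrArg (ℝ ∙ (e' - b))ᗮ.reflection this
      rw [Submodule.reflection_reflection] at h2
      exact h2.symm
    · exact tendsto_reflection_orthogonal_singleton (hu.sub_const b) hv (sub_ne_zero.2 h)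

end Isometries

/-! ### Taylor expansion along moving base points and directions. -/

section TaylorLimits

variable {d : ℕ} {φ : EuclideanSpace ℝ (Fin d) → ℝ} {x : EuclideanSpace ℝ (Fin d)}

lemma tendsto_taylor_remainder (hφ : ContDiff ℝ ∞ φ) {ι : Type*} {l : Filter ι} {r : ι → ℝ}
    {y ν : ι → EuclideanSpace ℝ (Fin d)} {ν₀ : EuclideanSpace ℝ (Fin d)}
    (hr : Tendsto r l (𝓝[>] 0)) (hy : Tendsto y l (𝓝 x)) (hν : Tendsto ν l (𝓝 ν₀)) :
    Tendsto (fun i => (φ (y i + r i • ν i) - φ (y i)) / r i ^ 2 -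
      inner ℝ (gradient φ (y i)) (ν i) / r i) l (𝓝 (inner ℝ (hessian φ x ν₀) ν₀ / 2)) := by
  choose ξ hξ hT using fun i => exists_taylor_two hφ (y i) (r i • ν i)
  have hr0 : Tendsto r l (𝓝 0) := hr.mono_right nhdsWithin_le_nhds
  have hpos : ∀ᶠ i in l, 0 < r i := hr.eventually self_mem_nhdsWithin
  have hrν : Tendsto (fun i => r i • ν i) l (𝓝 0) := by simpa using hr0.smul hν
  have hξ0 : Tendsto (fun i => ξ i • r i • ν i) l (𝓝 0) := by
    refine squeeze_zero_norm (fun i => ?_) (by simpa using hrν.norm)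
    rw [norm_smul, Real.norm_of_nonneg (hξ i).1]
    exact mul_le_of_le_one_left (norm_nonneg _) (hξ i).2
  have hpt : Tendsto (fun i => y i + ξ i • r i • ν i) l (𝓝 x) := by simpa using hy.add hξ0
  have hX := ((continuous_hessian hφ).tendsto x).comp hpt
  have hlim : Tendsto (fun i => inner ℝ (hessian φ (y i + ξ i • r i • ν i) (ν i)) (ν i) / 2) l
      (𝓝 (inner ℝ (hessian φ x ν₀) ν₀ / 2)) := (((isBoundedBilinearMap_apply.continuous.tendsto _).comp (hX.prodMk_nhds hν)).inner hν).div_const 2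
  refine hlim.congr' ?_
  filter_upwards [hpos] with i hi
  rw [hT i, map_smul, inner_smul_left, inner_smul_right, inner_smul_right]
  simp only [conj_trivial]
  field_simp
  ring

end TaylorLimits

/-! ### Pointwise limit and domination of the rescaled integrands. -/

section DominatedConvergence

variable {k : ℕ}

/-- The indicator of `S` minus that of the half-space of nonpositive first coordinate. -/
noncomputable def halfspaceDiscrepancy (S : Set (EuclideanSpace ℝ (Fin (k + 2))))
    (v : EuclideanSpace ℝ (Fin (k + 2))) : ℝ :=
  S.indicator (fun _ => 1) v - {v : EuclideanSpace ℝ (Fin (k + 2)) | v 0 ≤ 0}.indicator (fun _ => 1) v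

lemma measurable_halfspaceDiscrepancy {S : Set (EuclideanSpace ℝ (Fin (k + 2)))}
    (hS : MeasurableSet S) : Measurable (halfspaceDiscrepancy S) := by
  refine (measurable_const.indicator hS).sub (measurable_const.indicator ?_)
  have : Continuous fun v : EuclideanSpace ℝ (Fin (k + 2)) => v 0 := by fun_prop
  exact (isClosed_le this continuous_const).measurableSet

lemma abs_halfspaceDiscrepancy_le (S : Set (EuclideanSpace ℝ (Fin (k + 2))))
    (v : EuclideanSpace ℝ (Fin (k + 2))) : |halfspaceDiscrepancy S v| ≤ 1 := by
  unfold halfspaceDiscrepancy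
  by_cases h1 : v ∈ S <;>
    by_cases h2 : v ∈ {v : EuclideanSpace ℝ (Fin (k + 2)) | v 0 ≤ 0} <;> simp [h1, h2]

/-- The sublevel set of `φ` near `y` at height `φ y + m r²` in the rescaled variable. -/
def rescaledSublevel (φ : EuclideanSpace ℝ (Fin (k + 2)) → ℝ)
    (O : EuclideanSpace ℝ (Fin (k + 2)) ≃ₗᵢ[ℝ] EuclideanSpace ℝ (Fin (k + 2))) (r m : ℝ)
    (y : EuclideanSpace ℝ (Fin (k + 2))) : Set (EuclideanSpace ℝ (Fin (k + 2))) :=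
  {v | φ (y + r • O v) < φ y + m * r ^ 2}

lemma measurableSet_rescaledSublevel {φ : EuclideanSpace ℝ (Fin (k + 2)) → ℝ} (hφ : Continuous φ)
    (O : EuclideanSpace ℝ (Fin (k + 2)) ≃ₗᵢ[ℝ] EuclideanSpace ℝ (Fin (k + 2))) (r m : ℝ)
    (y : EuclideanSpace ℝ (Fin (k + 2))) : MeasurableSet (rescaledSublevel φ O r m y) := by
  have : Continuous fun v => φ (y + r • O v) := by
    have := O.continuous
    fun_prop
  exact (isOpen_lt this continuous_const).measurableSet

/-- The limiting height over `w` of the level set, in the direction of the gradient `p`. -/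
noncomputable def limitHeight (p : EuclideanSpace ℝ (Fin (k + 2)))
    (X : EuclideanSpace ℝ (Fin (k + 2)) →L[ℝ] EuclideanSpace ℝ (Fin (k + 2)))
    (O : EuclideanSpace ℝ (Fin (k + 2)) ≃ₗᵢ[ℝ] EuclideanSpace ℝ (Fin (k + 2))) (m ρ : ℝ)
    (w : EuclideanSpace ℝ (Fin (k + 1))) : ℝ :=
  (m * ‖w‖ - ρ ^ 2 / 2 * (‖w‖⁻¹ * inner ℝ (X (O (euclideanCons 0 w))) (O (euclideanCons 0 w)))) / ‖p‖

/-- The limit of the rescaled integrands of the discrepancy of a sublevel set. -/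
noncomputable def limitIntegrand (κ₀ : ℝ) (t : ℝ → EuclideanSpace ℝ (Fin (k + 1)) → ℝ)
    (p : (ℝ × EuclideanSpace ℝ (Fin (k + 1))) × ℝ) : ℝ :=
  if p.1.1 ∈ Ioo (0 : ℝ) 1 ∧ ‖p.1.2‖ < 1 then
    (κ₀ + (1 - κ₀) * p.1.1) ^ k * ((Iio (t (κ₀ + (1 - κ₀) * p.1.1) p.1.2)).indicator (fun _ => 1) p.2
      - (Iic 0).indicator (fun _ => 1) p.2)
  else 0

lemma inner_eq_norm_mul_coord {p : EuclideanSpace ℝ (Fin (k + 2))}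
    {O : EuclideanSpace ℝ (Fin (k + 2)) ≃ₗᵢ[ℝ] EuclideanSpace ℝ (Fin (k + 2))}
    (hO : ‖p‖ • O (EuclideanSpace.single 0 1) = p) (v : EuclideanSpace ℝ (Fin (k + 2))) :
    inner ℝ p (O v) = ‖p‖ * v 0 := by
  conv_lhs => rw [← hO]
  rw [inner_smul_left, O.inner_map_map]
  simp [EuclideanSpace.inner_single_left]

lemma rescaled_direction_coord {ρ r : ℝ} (hρ : 0 < ρ) (s : ℝ) (w : EuclideanSpace ℝ (Fin (k + 1))) :
    (ρ • ‖euclideanCons (r / ρ * s) w‖⁻¹ • euclideanCons (r / ρ * s) w) 0 =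
      r * (s / ‖euclideanCons (r / ρ * s) w‖) := by
  simp only [PiLp.smul_apply, euclideanCons_zero, smul_eq_mul]
  field_simp

variable {κ : ℝ → ℝ} {κ₀ : ℝ} {φ : EuclideanSpace ℝ (Fin (k + 2)) → ℝ}
  {x : EuclideanSpace ℝ (Fin (k + 2))}
  {O : EuclideanSpace ℝ (Fin (k + 2)) → EuclideanSpace ℝ (Fin (k + 2)) ≃ₗᵢ[ℝ] EuclideanSpace ℝ (Fin (k + 2))}

/-- The direction has first coordinate `r s / |z|`, so the gradient term is of order `r²`, like the
Hessian term. The two exceptions are `w = 0`, where the direction may have no limit, and the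
limiting level set itself, where the indicator jumps. -/
lemma tendsto_rescaledIntegrand (hκ₁ : κ₀ ∈ Icc (0 : ℝ) 1) (hκ₀ : Tendsto κ (𝓝[>] 0) (𝓝 κ₀))
    (hφ : ContDiff ℝ ∞ φ) (hp : gradient φ x ≠ 0)
    (hO : ∀ᶠ y in 𝓝 x, ‖gradient φ y‖ • O y (EuclideanSpace.single 0 1) = gradient φ y)
    (hOc : ∀ (v : ℝ × EuclideanSpace ℝ (Fin (k + 2)) → EuclideanSpace ℝ (Fin (k + 2)))
      (v₀ : EuclideanSpace ℝ (Fin (k + 2))), Tendsto v (𝓝[>] 0 ×ˢ 𝓝 x) (𝓝 v₀) →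
        Tendsto (fun q => O q.2 (v q)) (𝓝[>] 0 ×ˢ 𝓝 x) (𝓝 (O x v₀)))
    (m : ℝ) {u s : ℝ} {w : EuclideanSpace ℝ (Fin (k + 1))} (hw0 : w ≠ 0)
    (hs : s ≠ limitHeight (gradient φ x) (hessian φ x) (O x) m (κ₀ + (1 - κ₀) * u) w) :
    Tendsto (fun q : ℝ × EuclideanSpace ℝ (Fin (k + 2)) => rescaledIntegrand k (κ q.1) q.1
      (halfspaceDiscrepancy (rescaledSublevel φ (O q.2) q.1 m q.2)) ((u, w), s)) (𝓝[>] 0 ×ˢ 𝓝 x)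
      (𝓝 (limitIntegrand κ₀ (limitHeight (gradient φ x) (hessian φ x) (O x) m) ((u, w), s))) := by
  set l : Filter (ℝ × EuclideanSpace ℝ (Fin (k + 2))) := 𝓝[>] 0 ×ˢ 𝓝 x with hl
  by_cases hu : u ∈ Ioo (0 : ℝ) 1
  swap
  · have h1 : ∀ q : ℝ × EuclideanSpace ℝ (Fin (k + 2)), rescaledIntegrand k (κ q.1) q.1
      (halfspaceDiscrepancy (rescaledSublevel φ (O q.2) q.1 m q.2)) ((u, w), s) = 0 :=
      fun q => if_neg fun h => hu h.1
    have h2 : limitIntegrand κ₀ (limitHeight (gradient φ x) (hessian φ x) (O x) m) ((u, w), s) = 0 :=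
      if_neg fun h => hu h.1
    simp only [h1, h2]
    exact tendsto_const_nhds
  by_cases hw1 : ‖w‖ < 1
  swap
  · have h1 : ∀ q : ℝ × EuclideanSpace ℝ (Fin (k + 2)), rescaledIntegrand k (κ q.1) q.1
      (halfspaceDiscrepancy (rescaledSublevel φ (O q.2) q.1 m q.2)) ((u, w), s) = 0 :=
      fun q => if_neg fun h => hw1 ((norm_le_norm_euclideanCons _ _).trans_lt h.2)
    have h2 : limitIntegrand κ₀ (limitHeight (gradient φ x) (hessian φ x) (O x) m) ((u, w), s) = 0 :=
      if_neg fun h => hw1 h.2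
    simp only [h1, h2]
    exact tendsto_const_nhds
  have hr : Tendsto (fun q : ℝ × EuclideanSpace ℝ (Fin (k + 2)) => q.1) l (𝓝[>] 0) := tendsto_fst
  have hy : Tendsto (fun q : ℝ × EuclideanSpace ℝ (Fin (k + 2)) => q.2) l (𝓝 x) := tendsto_snd
  have hr0 := hr.mono_right nhdsWithin_le_nhds
  have hrpos : ∀ᶠ q in l, 0 < q.1 := hr.eventually self_mem_nhdsWithin
  set ρ₀ := κ₀ + (1 - κ₀) * u with hρ₀
  have hρ₀pos : 0 < ρ₀ := by
    rw [hρ₀]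
    nlinarith [hκ₁.1, hκ₁.2, hu.1, hu.2]
  set ρ : ℝ × EuclideanSpace ℝ (Fin (k + 2)) → ℝ := fun q => κ q.1 + (1 - κ q.1) * u with hρ
  have hρlim : Tendsto ρ l (𝓝 ρ₀) :=
    (hκ₀.comp hr).add (((hκ₀.comp hr).const_sub 1).mul_const u)
  have hρpos : ∀ᶠ q in l, 0 < ρ q := hρlim.eventually_const_lt hρ₀pos
  set z : ℝ × EuclideanSpace ℝ (Fin (k + 2)) → EuclideanSpace ℝ (Fin (k + 2)) :=
    fun q => euclideanCons (q.1 / ρ q * s) w with hz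
  have hzlim : Tendsto z l (𝓝 (euclideanCons 0 w)) := by
    have h1 : Tendsto (fun q => q.1 / ρ q * s) l (𝓝 0) := by
      simpa using (hr0.div hρlim hρ₀pos.ne').mul_const s
    exact (continuous_euclideanCons.tendsto (0, w)).comp (h1.prodMk_nhds tendsto_const_nhds)
  have hwpos : 0 < ‖w‖ := norm_pos_iff.2 hw0
  have hznorm : Tendsto (fun q => ‖z q‖) l (𝓝 ‖w‖) := by
    simpa using hzlim.norm
  have hzpos : ∀ q, 0 < ‖z q‖ := fun q => hwpos.trans_le (norm_le_norm_euclideanCons _ _)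
  set v : ℝ × EuclideanSpace ℝ (Fin (k + 2)) → EuclideanSpace ℝ (Fin (k + 2)) :=
    fun q => ρ q • ‖z q‖⁻¹ • z q with hv
  have hvlim : Tendsto v l (𝓝 (ρ₀ • ‖w‖⁻¹ • euclideanCons 0 w)) :=
    hρlim.smul ((hznorm.inv₀ hwpos.ne').smul hzlim)
  have hT := tendsto_taylor_remainder hφ hr hy (hOc v _ hvlim)
  have hpy : Tendsto (fun q : ℝ × EuclideanSpace ℝ (Fin (k + 2)) => ‖gradient φ q.2‖) l
      (𝓝 ‖gradient φ x‖) := (((continuous_gradient hφ).tendsto x).comp hy).norm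
  have hlin : Tendsto (fun q : ℝ × EuclideanSpace ℝ (Fin (k + 2)) =>
      inner ℝ (gradient φ q.2) (O q.2 (v q)) / q.1) l (𝓝 (‖gradient φ x‖ * (s / ‖w‖))) := by
    have hsz : Tendsto (fun q => s / ‖z q‖) l (𝓝 (s / ‖w‖)) :=
      tendsto_const_nhds.div hznorm hwpos.ne'
    refine (hpy.mul hsz).congr' ?_
    filter_upwards [hy.eventually hO, hrpos, hρpos] with q hq hr hρq
    rw [inner_eq_norm_mul_coord hq,
      show v q 0 = q.1 * (s / ‖z q‖) from rescaled_direction_coord hρq s w, mul_left_comm,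
      mul_div_cancel_left₀ _ hr.ne']
  have hlim := hT.add hlin
  simp only [sub_add_cancel] at hlim
  set a : ℝ := inner ℝ (hessian φ x (O x (ρ₀ • ‖w‖⁻¹ • euclideanCons 0 w)))
      (O x (ρ₀ • ‖w‖⁻¹ • euclideanCons 0 w)) / 2 + ‖gradient φ x‖ * (s / ‖w‖) with ha
  have hppos : 0 < ‖gradient φ x‖ := norm_pos_iff.2 hp
  -- The limit of the rescaled increment of `φ` compares with `m` exactly as `s` compares with the
  -- limiting height.
  have hiff : a - m = ‖gradient φ x‖ / ‖w‖ *
      (s - limitHeight (gradient φ x) (hessian φ x) (O x) m ρ₀ w) := by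
    rw [ha, limitHeight]
    simp only [map_smul, inner_smul_left, inner_smul_right, conj_trivial]
    field_simp
    ring
  have hc : 0 < ‖gradient φ x‖ / ‖w‖ := div_pos hppos hwpos
  have hS : ∀ᶠ q in l, (rescaledSublevel φ (O q.2) q.1 m q.2).indicator (fun _ => (1 : ℝ)) (v q) =
      (Iio (limitHeight (gradient φ x) (hessian φ x) (O x) m ρ₀ w)).indicator (fun _ => 1) s := by
    have hmem : ∀ q : ℝ × EuclideanSpace ℝ (Fin (k + 2)), 0 < q.1 →
        (v q ∈ rescaledSublevel φ (O q.2) q.1 m q.2 ↔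
          (φ (q.2 + q.1 • O q.2 (v q)) - φ q.2) / q.1 ^ 2 < m) := fun q hq => by
      rw [div_lt_iff₀ (by positivity), sub_lt_iff_lt_add']
      rfl
    rcases hs.lt_or_gt with h | h
    · have : a < m := by
        have := mul_neg_of_pos_of_neg hc (sub_neg.2 h)
        linarith
      filter_upwards [hlim.eventually_lt_const this, hrpos] with q hq hr
      rw [indicator_of_mem ((hmem q hr).2 hq), indicator_of_mem (show s ∈ Iio _ from h)]
    · have : m < a := by
        have := mul_pos hc (sub_pos.2 h)
        linarith
      filter_upwards [hlim.eventually_const_lt this, hrpos] with q hq hr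
      rw [indicator_of_notMem (fun h' => hq.not_gt ((hmem q hr).1 h')),
        indicator_of_notMem (fun h' : s ∈ Iio _ => h.not_gt h')]
  have hlimp : Tendsto (fun q => ρ q ^ k *
      ((Iio (limitHeight (gradient φ x) (hessian φ x) (O x) m ρ₀ w)).indicator (fun _ => (1 : ℝ)) s
        - (Iic 0).indicator (fun _ => 1) s)) l
      (𝓝 (limitIntegrand κ₀ (limitHeight (gradient φ x) (hessian φ x) (O x) m) ((u, w), s))) := by
    rw [limitIntegrand, if_pos ⟨hu, hw1⟩]
    exact (hρlim.pow k).mul_const _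
  refine hlimp.congr' ?_
  filter_upwards [hS, hrpos, hρpos, hznorm.eventually_lt_const hw1] with q hSq hr hρq hzq
  rw [rescaledIntegrand, if_pos ⟨hu, hzq⟩]
  congr 1
  change _ = halfspaceDiscrepancy (rescaledSublevel φ (O q.2) q.1 m q.2) (v q)
  rw [halfspaceDiscrepancy, hSq]
  congr 1
  have hv0 : v q 0 = q.1 * (s / ‖z q‖) := rescaled_direction_coord hρq s w
  have hiff0 : v q 0 ≤ 0 ↔ s ≤ 0 := by
    rw [hv0]
    refine ⟨fun h => ?_, fun h => mul_nonpos_of_nonneg_of_nonpos hr.le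
      (div_nonpos_of_nonpos_of_nonneg h (hzpos q).le)⟩
    by_contra! h'
    exact h.not_gt (mul_pos hr (div_pos h' (hzpos q)))
  by_cases h : s ≤ 0
  · rw [indicator_of_mem (show s ∈ Iic 0 from h),
      indicator_of_mem (show v q ∈ {v : EuclideanSpace ℝ (Fin (k + 2)) | v 0 ≤ 0} from hiff0.2 h)]
  · rw [indicator_of_notMem (show s ∉ Iic 0 from h), indicator_of_notMem
      (show v q ∉ {v : EuclideanSpace ℝ (Fin (k + 2)) | v 0 ≤ 0} from fun h' => h (hiff0.1 h'))]

/-- Far from the hyperplane the gradient term decides the sign, so sublevel set and half-space agree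
and the integrand vanishes. The support therefore stays in a box independent of `r` and `y`. -/
lemma exists_bound_rescaledIntegrand (hκ : ∀ r : ℝ, 0 < r → κ r ∈ Ico (0 : ℝ) 1)
    (hφ : ContDiff ℝ ∞ φ) (hp : gradient φ x ≠ 0)
    (hO : ∀ᶠ y in 𝓝 x, ‖gradient φ y‖ • O y (EuclideanSpace.single 0 1) = gradient φ y) (m : ℝ) :
    ∃ K : ℝ, ∀ᶠ q : ℝ × EuclideanSpace ℝ (Fin (k + 2)) in 𝓝[>] 0 ×ˢ 𝓝 x,
      ∀ p, ‖rescaledIntegrand k (κ q.1) q.1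
        (halfspaceDiscrepancy (rescaledSublevel φ (O q.2) q.1 m q.2)) p‖ ≤
        ((Ioo (0 : ℝ) 1 ×ˢ Metric.ball (0 : EuclideanSpace ℝ (Fin (k + 1))) 1) ×ˢ
          Icc (-K) K).indicator (fun _ => 1) p := by
  set M := ‖hessian φ x‖ + 1
  have hppos : 0 < ‖gradient φ x‖ := norm_pos_iff.2 hp
  -- Near `x` the gradient has norm at least half of its value at `x`. Beyond `K` the linear term
  -- thus exceeds `|m|` plus the Taylor remainder, in units of `r²`.
  set K := (|m| + M + 1) / (‖gradient φ x‖ / 2) with hK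
  have hM : 0 < M := by positivity
  refine ⟨K, ?_⟩
  have hpy : ∀ᶠ y in 𝓝 x, ‖gradient φ x‖ / 2 < ‖gradient φ y‖ :=
    (continuous_gradient hφ).norm.continuousAt.eventually_const_lt (half_lt_self hppos)
  filter_upwards [eventually_taylor_bound hφ (lt_add_one ‖hessian φ x‖),
    Eventually.prod_inl (p := fun r => 0 < r) self_mem_nhdsWithin _,
    Eventually.prod_inr hO _, Eventually.prod_inr hpy _] with ⟨r, y⟩ hT hr hO hpy
  rintro ⟨⟨u, w⟩, s⟩
  simp only at hT hr hO hpy ⊢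
  have hκr := hκ r hr
  by_cases hmem : ((u, w), s) ∈ (Ioo (0 : ℝ) 1 ×ˢ
      Metric.ball (0 : EuclideanSpace ℝ (Fin (k + 1))) 1) ×ˢ Icc (-K) K
  · rw [indicator_of_mem hmem]
    exact abs_rescaledIntegrand_le hκr (abs_halfspaceDiscrepancy_le _) _
  rw [indicator_of_notMem hmem, norm_le_zero_iff, rescaledIntegrand]
  simp only
  split_ifs with h
  swap
  · rfl
  obtain ⟨hu, hz⟩ := h
  have hρ := radius_pos hκr hu
  have hρ1 := radius_le_one hκr.2.le hu.2.le
  set ρ := κ r + (1 - κ r) * u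
  set z := euclideanCons (r / ρ * s) w with hzdef
  have hw : w ∈ Metric.ball (0 : EuclideanSpace ℝ (Fin (k + 1))) 1 := by
    simpa using (norm_le_norm_euclideanCons _ _).trans_lt hz
  have hsK : K < |s| := by
    by_contra! h
    exact hmem ⟨⟨hu, hw⟩, abs_le.1 h⟩
  have hKpos : 0 < K := by positivity
  have hs0 : s ≠ 0 := abs_pos.1 (hKpos.trans hsK)
  have hzpos : 0 < ‖z‖ := by
    refine lt_of_lt_of_le (abs_pos.2 ?_) (abs_le_norm_euclideanCons _ _)
    have := hr.ne'
    have := hρ.ne'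
    positivity
  set v := ρ • ‖z‖⁻¹ • z with hv
  have hvn : ‖O y v‖ ≤ 1 := by
    rw [LinearIsometryEquiv.norm_map, hv, norm_smul, norm_smul, norm_inv, norm_norm,
      inv_mul_cancel₀ hzpos.ne', mul_one, Real.norm_of_nonneg hρ.le]
    exact hρ1
  have hv0 : v 0 = r * (s / ‖z‖) := rescaled_direction_coord hρ s w
  have hTv := hT _ hvn
  rw [inner_eq_norm_mul_coord hO, hv0] at hTv
  have hKm : ‖gradient φ x‖ / 2 * K = |m| + M + 1 := by
    rw [hK]
    field_simp
  have hbig : |m| + M + 1 ≤ ‖gradient φ y‖ * (|s| / ‖z‖) := by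
    rw [← hKm]
    have : |s| ≤ |s| / ‖z‖ := le_div_self (abs_nonneg s) hzpos hz.le
    gcongr
    exact hsK.le.trans this
  have hr2 : 0 < r ^ 2 := by positivity
  have hbig2 := mul_le_mul_of_nonneg_left hbig hr2.le
  have hm1 := mul_le_mul_of_nonneg_left (le_abs_self m) hr2.le
  have hm2 := mul_le_mul_of_nonneg_left (neg_abs_le m) hr2.le
  have hMr : 0 < M * r ^ 2 := by positivity
  have hD : halfspaceDiscrepancy (rescaledSublevel φ (O y) r m y) v = 0 := by
    rw [halfspaceDiscrepancy]
    rcases lt_or_gt_of_ne hs0 with hs | hs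
    · rw [abs_of_neg hs] at hbig2
      have h1 : v ∈ rescaledSublevel φ (O y) r m y := by
        change φ (y + r • O y v) < φ y + m * r ^ 2
        have := (abs_le.1 hTv).2
        rw [neg_div] at hbig2
        nlinarith
      have h2 : v ∈ {v : EuclideanSpace ℝ (Fin (k + 2)) | v 0 ≤ 0} := by
        change v 0 ≤ 0
        rw [hv0]
        exact mul_nonpos_of_nonneg_of_nonpos hr.le (div_nonpos_of_nonpos_of_nonneg hs.le hzpos.le)
      rw [indicator_of_mem h1, indicator_of_mem h2, sub_self]
    · rw [abs_of_pos hs] at hbig2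
      have h1 : v ∉ rescaledSublevel φ (O y) r m y := by
        change ¬ φ (y + r • O y v) < φ y + m * r ^ 2
        have := (abs_le.1 hTv).1
        nlinarith
      have h2 : v ∉ {v : EuclideanSpace ℝ (Fin (k + 2)) | v 0 ≤ 0} := by
        change ¬ v 0 ≤ 0
        rw [hv0, not_le]
        positivity
      rw [indicator_of_notMem h1, indicator_of_notMem h2, sub_self]
  rw [hD, mul_zero]

end DominatedConvergence

/-! ### The stencil constant as a ratio of radial moments. -/

section StencilConstant

lemma integral_radius_pow (κ₀ : ℝ) (j : ℕ) :
    ((j : ℝ) + 1) * (1 - κ₀) * ∫ u in (0 : ℝ)..1, (κ₀ + (1 - κ₀) * u) ^ j = 1 - κ₀ ^ (j + 1) := by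
  have h := intervalIntegral.mul_integral_comp_add_mul (a := 0) (b := 1)
    (f := fun ρ : ℝ => ρ ^ j) (c := 1 - κ₀) (d := κ₀)
  rw [mul_assoc, h, integral_pow, mul_zero, add_zero, mul_one, add_sub_cancel, one_pow]
  field_simp

lemma integral_radius_pow_pos {κ₀ : ℝ} (hκ₁ : κ₀ ∈ Icc (0 : ℝ) 1) (j : ℕ) :
    0 < ∫ u in (0 : ℝ)..1, (κ₀ + (1 - κ₀) * u) ^ j := by
  refine intervalIntegral.intervalIntegral_pos_of_pos_on ?_ (fun u hu => pow_pos ?_ _) zero_lt_one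
  · exact Continuous.intervalIntegrable (by fun_prop) _ _
  · nlinarith [hκ₁.1, hκ₁.2, hu.1, hu.2]

/-- With `d = k + 2`, the constant is the ratio of the moments of `ρ^d` and `ρ^(d-2)`, divided by
`2(d-1)`. In the variable `u` this also covers `κ₀ = 1`, where both moments equal `1`. -/
lemma stencilConstant_mul_integral {κ₀ : ℝ} (hκ₁ : κ₀ ∈ Icc (0 : ℝ) 1) (k : ℕ) :
    stencilConstant (k + 2) κ₀ * ∫ u in (0 : ℝ)..1, (κ₀ + (1 - κ₀) * u) ^ k =
      (∫ u in (0 : ℝ)..1, (κ₀ + (1 - κ₀) * u) ^ (k + 2)) / (2 * (k + 1)) := by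
  unfold stencilConstant
  split_ifs with h
  · subst h
    simp
    ring
  · have h1 := integral_radius_pow κ₀ k
    have h2 := integral_radius_pow κ₀ (k + 2)
    have hlt : κ₀ < 1 := lt_of_le_of_ne hκ₁.2 h
    have h3 : (1 - κ₀) ≠ 0 := (sub_pos.2 hlt).ne'
    have h4 : 1 - κ₀ ^ (k + 1) ≠ 0 := (sub_pos.2 (pow_lt_one₀ hκ₁.1 hlt (by omega))).ne'
    rw [show k + 2 - 1 = k + 1 from rfl]
    have h5 : (∫ u in (0 : ℝ)..1, (κ₀ + (1 - κ₀) * u) ^ k) =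
        (1 - κ₀ ^ (k + 1)) / ((k + 1) * (1 - κ₀)) := by
      rw [← h1]
      field_simp
    have h6 : (∫ u in (0 : ℝ)..1, (κ₀ + (1 - κ₀) * u) ^ (k + 2)) =
        (1 - κ₀ ^ (k + 2 + 1)) / ((k + 2 + 1) * (1 - κ₀)) := by
      rw [← h2]
      push_cast
      field_simp
    rw [h5, h6]
    push_cast
    field_simp

end StencilConstant

/-! ### Integrating the limiting height. -/

section LimitIntegral

variable {k : ℕ}

lemma integral_indicator_Iio_sub_Iic (t : ℝ) :
    ∫ s : ℝ, ((Iio t).indicator (fun _ => (1 : ℝ)) s - (Iic 0).indicator (fun _ => 1) s) = t := by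
  rcases lt_or_ge 0 t with h | h
  · have : ∀ s : ℝ, (Iio t).indicator (fun _ => (1 : ℝ)) s - (Iic 0).indicator (fun _ => 1) s =
        (Ioo 0 t).indicator (fun _ => 1) s := by
      intro s
      simp only [indicator_apply, mem_Iio, mem_Iic, mem_Ioo]
      split_ifs <;> grind
    simp only [this]
    rw [integral_indicator measurableSet_Ioo]
    simp [h.le]
  · have : ∀ s : ℝ, (Iio t).indicator (fun _ => (1 : ℝ)) s - (Iic 0).indicator (fun _ => 1) s =
        -(Icc t 0).indicator (fun _ => 1) s := by
      intro s
      simp only [indicator_apply, mem_Iio, mem_Iic, mem_Icc]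
      split_ifs <;> grind
    simp only [this]
    rw [integral_neg, integral_indicator measurableSet_Icc]
    simp [h]

lemma euclideanCons_zero_add (w w' : EuclideanSpace ℝ (Fin k)) :
    euclideanCons 0 (w + w') = euclideanCons 0 w + euclideanCons 0 w' := by
  ext i
  refine Fin.cases ?_ (fun j => ?_) i <;> simp

lemma euclideanCons_zero_smul (c : ℝ) (w : EuclideanSpace ℝ (Fin k)) :
    euclideanCons 0 (c • w) = c • euclideanCons 0 w := by
  ext i
  refine Fin.cases ?_ (fun j => ?_) i <;> simp

/-- The bilinear form of `X`, restricted to the image under `O` of a coordinate hyperplane. -/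
noncomputable def tangentialForm (X : EuclideanSpace ℝ (Fin (k + 1)) →L[ℝ] EuclideanSpace ℝ (Fin (k + 1)))
    (O : EuclideanSpace ℝ (Fin (k + 1)) ≃ₗᵢ[ℝ] EuclideanSpace ℝ (Fin (k + 1))) :
    LinearMap.BilinForm ℝ (EuclideanSpace ℝ (Fin k)) :=
  LinearMap.mk₂ ℝ (fun w w' => inner ℝ (X (O (euclideanCons 0 w))) (O (euclideanCons 0 w')))
    (fun _ _ _ => by simp only [euclideanCons_zero_add, map_add, inner_add_left])
    (fun _ _ _ => by simp [euclideanCons_zero_smul, inner_smul_left])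
    (fun _ _ _ => by simp only [euclideanCons_zero_add, map_add, inner_add_right])
    (fun _ _ _ => by simp [euclideanCons_zero_smul, inner_smul_right])

/-- The trace may be computed in the image under `O` of the standard basis; dropping its first
vector leaves the tangential part. -/
lemma sum_tangentialForm (X : EuclideanSpace ℝ (Fin (k + 1)) →L[ℝ] EuclideanSpace ℝ (Fin (k + 1)))
    (O : EuclideanSpace ℝ (Fin (k + 1)) ≃ₗᵢ[ℝ] EuclideanSpace ℝ (Fin (k + 1))) :
    ∑ i, tangentialForm X O (EuclideanSpace.basisFun (Fin k) ℝ i) (EuclideanSpace.basisFun (Fin k) ℝ i) =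
      LinearMap.trace ℝ _ (X : EuclideanSpace ℝ (Fin (k + 1)) →ₗ[ℝ] EuclideanSpace ℝ (Fin (k + 1)))
        - inner ℝ (O (EuclideanSpace.single 0 1)) (X (O (EuclideanSpace.single 0 1))) := by
  rw [LinearMap.trace_eq_sum_inner _ ((EuclideanSpace.basisFun (Fin (k + 1)) ℝ).map O),
    Fin.sum_univ_succ]
  simp only [OrthonormalBasis.map_apply, EuclideanSpace.basisFun_apply, ContinuousLinearMap.coe_coe,
    add_sub_cancel_left]
  refine Finset.sum_congr rfl fun i _ => ?_
  have : euclideanCons 0 (EuclideanSpace.single i (1 : ℝ)) = EuclideanSpace.single i.succ 1 := by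
    ext j
    refine Fin.cases ?_ (fun j => ?_) j
    · simp [(Fin.succ_ne_zero i).symm]
    · simp
  simp only [tangentialForm, LinearMap.mk₂_apply, this]
  rw [real_inner_comm]

lemma integral_norm_ball_pos :
    0 < ∫ w in Metric.ball (0 : EuclideanSpace ℝ (Fin (k + 1))) 1, ‖w‖ := by
  have hint : IntegrableOn (fun w : EuclideanSpace ℝ (Fin (k + 1)) => ‖w‖) (Metric.ball 0 1) :=
    (continuous_norm.continuousOn.integrableOn_compact (isCompact_closedBall 0 1)).mono_set
      Metric.ball_subset_closedBall
  rw [setIntegral_pos_iff_support_of_nonneg_ae (ae_of_all _ fun w => norm_nonneg w) hint]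
  refine IsOpen.measure_pos _ ((continuous_norm.isOpen_support).inter Metric.isOpen_ball) ?_
  exact ⟨EuclideanSpace.single 0 (1 / 2), by simp [Function.mem_support], by
    simp; norm_num⟩

/-- The product of coordinates is at most `‖w‖²`, which absorbs the singular weight. -/
lemma integrable_norm_inv_mul_coord (i j : Fin (k + 1)) :
    Integrable fun w : EuclideanSpace ℝ (Fin (k + 1)) =>
      (if ‖w‖ < 1 then ‖w‖⁻¹ else 0) * (w i * w j) := by
  have hb : Integrable ((Metric.ball (0 : EuclideanSpace ℝ (Fin (k + 1))) 1).indicator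
      fun _ => (1 : ℝ)) :=
    (integrable_indicator_iff measurableSet_ball).2 (integrableOn_const measure_ball_lt_top.ne)
  refine hb.mono' ?_ (ae_of_all _ fun w => ?_)
  · have hm : Measurable fun w : EuclideanSpace ℝ (Fin (k + 1)) => if ‖w‖ < 1 then ‖w‖⁻¹ else 0 :=
      Measurable.ite (measurableSet_lt measurable_norm measurable_const) measurable_norm.inv
        measurable_const
    have hij : Measurable fun w : EuclideanSpace ℝ (Fin (k + 1)) => w i * w j := by fun_prop
    exact (hm.mul hij).aestronglyMeasurable
  · by_cases hw : ‖w‖ < 1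
    · rw [indicator_of_mem (by simpa using hw), if_pos hw]
      have hi : |w i| ≤ ‖w‖ := by simpa using PiLp.norm_apply_le w i
      have hj : |w j| ≤ ‖w‖ := by simpa using PiLp.norm_apply_le w j
      rw [norm_mul, norm_inv, norm_norm, Real.norm_eq_abs, abs_mul]
      rcases (norm_nonneg w).eq_or_lt with h0 | h0
      · simp [← h0]
      · rw [inv_mul_le_iff₀ h0, mul_one]
        calc |w i| * |w j| ≤ ‖w‖ * ‖w‖ := by gcongr
          _ ≤ ‖w‖ * 1 := by gcongr
          _ = ‖w‖ := mul_one _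
    · rw [if_neg hw, zero_mul, norm_zero]
      exact indicator_nonneg (fun _ _ => zero_le_one) _

/-- The weight `‖w‖⁻¹` is radial, so the quadratic term averages to the tangential trace over `k +
1`, times the same integral of `‖w‖` that multiplies `m`. -/
lemma setIntegral_limitHeight (p : EuclideanSpace ℝ (Fin (k + 2)))
    (X : EuclideanSpace ℝ (Fin (k + 2)) →L[ℝ] EuclideanSpace ℝ (Fin (k + 2)))
    (O : EuclideanSpace ℝ (Fin (k + 2)) ≃ₗᵢ[ℝ] EuclideanSpace ℝ (Fin (k + 2))) (m ρ : ℝ) :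
    ∫ w in Metric.ball (0 : EuclideanSpace ℝ (Fin (k + 1))) 1, limitHeight p X O m ρ w =
      (∫ w in Metric.ball (0 : EuclideanSpace ℝ (Fin (k + 1))) 1, ‖w‖) / ‖p‖ *
        (m - ρ ^ 2 * ((LinearMap.trace ℝ _
          (X : EuclideanSpace ℝ (Fin (k + 2)) →ₗ[ℝ] EuclideanSpace ℝ (Fin (k + 2)))
        - inner ℝ (O (EuclideanSpace.single 0 1)) (X (O (EuclideanSpace.single 0 1)))) /
          (2 * (k + 1)))) := by
  set g : ℝ → ℝ := fun t => if t < 1 then t⁻¹ else 0 with hg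
  have hgi : ∀ i j : Fin (k + 1), Integrable fun w : EuclideanSpace ℝ (Fin (k + 1)) =>
    g ‖w‖ * (w i * w j) := integrable_norm_inv_mul_coord
  have hB := integral_radial_mul_bilinForm g hgi (tangentialForm X O)
  rw [sum_tangentialForm] at hB
  have hind : ∀ f : EuclideanSpace ℝ (Fin (k + 1)) → ℝ,
      (Metric.ball (0 : EuclideanSpace ℝ (Fin (k + 1))) 1).indicator (fun w => ‖w‖⁻¹ * f w) =
        fun w => g ‖w‖ * f w := by
    intro f
    funext w
    by_cases hw : ‖w‖ < 1
    · simp only [hg]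
      rw [indicator_of_mem (by simpa using hw), if_pos hw]
    · simp only [hg]
      rw [indicator_of_notMem (by simpa using hw), if_neg hw, zero_mul]
  have hconv : ∀ f : EuclideanSpace ℝ (Fin (k + 1)) → ℝ,
      ∫ w in Metric.ball (0 : EuclideanSpace ℝ (Fin (k + 1))) 1, ‖w‖⁻¹ * f w =
        ∫ w, g ‖w‖ * f w := fun f => by
    rw [← integral_indicator measurableSet_ball, hind]
  have hJ : ∫ w : EuclideanSpace ℝ (Fin (k + 1)), g ‖w‖ * ‖w‖ ^ 2 =
      ∫ w in Metric.ball (0 : EuclideanSpace ℝ (Fin (k + 1))) 1, ‖w‖ := by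
    rw [← hconv]
    congr 1
    funext w
    rcases (norm_nonneg w).eq_or_lt with h0 | h0
    · simp [← h0]
    · field_simp
  have hn : IntegrableOn (fun w : EuclideanSpace ℝ (Fin (k + 1)) => m * ‖w‖) (Metric.ball 0 1) :=
    ((continuous_const.mul continuous_norm).continuousOn.integrableOn_compact
      (isCompact_closedBall 0 1)).mono_set Metric.ball_subset_closedBall
  have hq : IntegrableOn (fun w : EuclideanSpace ℝ (Fin (k + 1)) =>
      ‖w‖⁻¹ * tangentialForm X O w w) (Metric.ball 0 1) := by
    rw [← integrable_indicator_iff measurableSet_ball, hind]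
    exact integrable_radial_mul_bilinForm hgi _
  have ht : ∀ w, limitHeight p X O m ρ w =
      (m * ‖w‖ - ρ ^ 2 / 2 * (‖w‖⁻¹ * tangentialForm X O w w)) / ‖p‖ := fun w => rfl
  simp only [ht]
  rw [integral_div, integral_sub hn (hq.const_mul _), integral_const_mul, integral_const_mul, hconv,
    hB, hJ]
  push_cast
  field_simp

end LimitIntegral

/-! ### Points with nonzero gradient. -/

section NondegenerateGradient

variable {k : ℕ} {κ : ℝ → ℝ} {κ₀ : ℝ} {φ : EuclideanSpace ℝ (Fin (k + 2)) → ℝ}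
  {x : EuclideanSpace ℝ (Fin (k + 2))}
  {O : EuclideanSpace ℝ (Fin (k + 2)) → EuclideanSpace ℝ (Fin (k + 2)) ≃ₗᵢ[ℝ] EuclideanSpace ℝ (Fin (k + 2))}

lemma measurable_limitHeight (p : EuclideanSpace ℝ (Fin (k + 2)))
    (X : EuclideanSpace ℝ (Fin (k + 2)) →L[ℝ] EuclideanSpace ℝ (Fin (k + 2)))
    (O : EuclideanSpace ℝ (Fin (k + 2)) ≃ₗᵢ[ℝ] EuclideanSpace ℝ (Fin (k + 2))) (m κ₀ : ℝ) :
    Measurable fun p' : ℝ × EuclideanSpace ℝ (Fin (k + 1)) =>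
      limitHeight p X O m (κ₀ + (1 - κ₀) * p'.1) p'.2 := by
  have hc : Continuous fun p' : ℝ × EuclideanSpace ℝ (Fin (k + 1)) => O (euclideanCons 0 p'.2) :=
    O.continuous.comp (continuous_euclideanCons.comp (continuous_const.prodMk continuous_snd))
  have hq : Measurable fun p' : ℝ × EuclideanSpace ℝ (Fin (k + 1)) =>
      inner ℝ (X (O (euclideanCons 0 p'.2))) (O (euclideanCons 0 p'.2)) :=
    ((X.continuous.comp hc).inner hc).measurable
  unfold limitHeight
  fun_prop

lemma measurable_limitIntegrand {t : ℝ → EuclideanSpace ℝ (Fin (k + 1)) → ℝ}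
    (ht : Measurable fun p : ℝ × EuclideanSpace ℝ (Fin (k + 1)) => t (κ₀ + (1 - κ₀) * p.1) p.2) :
    Measurable (limitIntegrand κ₀ t) := by
  refine Measurable.ite ?_ ?_ measurable_const
  · exact (measurableSet_Ioo.preimage (measurable_fst.comp measurable_fst)).inter
      (measurableSet_lt (measurable_snd.comp measurable_fst).norm measurable_const)
  · have h1 : Measurable fun p : (ℝ × EuclideanSpace ℝ (Fin (k + 1))) × ℝ =>
        (κ₀ + (1 - κ₀) * p.1.1) ^ k := by fun_prop
    have h2 : Measurable fun p : (ℝ × EuclideanSpace ℝ (Fin (k + 1))) × ℝ =>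
        (Iic (0 : ℝ)).indicator (fun _ => (1 : ℝ)) p.2 :=
      (measurable_const.indicator measurableSet_Iic).comp measurable_snd
    have h3 : Measurable fun p : (ℝ × EuclideanSpace ℝ (Fin (k + 1))) × ℝ =>
        (Iio (t (κ₀ + (1 - κ₀) * p.1.1) p.1.2)).indicator (fun _ => (1 : ℝ)) p.2 :=
      Measurable.ite (measurableSet_lt measurable_snd (ht.comp measurable_fst)) measurable_const
        measurable_const
    exact h1.mul (h3.sub h2)

/-- The exceptional set of the pointwise limit is null, since each line in the `s` direction meets a
graph in one point. -/
lemma ae_ne_graph {t : ℝ × EuclideanSpace ℝ (Fin (k + 1)) → ℝ} (ht : Measurable t) :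
    ∀ᵐ p : (ℝ × EuclideanSpace ℝ (Fin (k + 1))) × ℝ, p.1.2 ≠ 0 ∧ p.2 ≠ t p.1 := by
  have h1 : MeasurableSet {p : (ℝ × EuclideanSpace ℝ (Fin (k + 1))) × ℝ | p.2 = t p.1} :=
    measurableSet_eq_fun measurable_snd (ht.comp measurable_fst)
  have h2 : ∀ᵐ p : (ℝ × EuclideanSpace ℝ (Fin (k + 1))) × ℝ, p.2 ≠ t p.1 := by
    rw [ae_iff]
    simp only [ne_eq, not_not]
    rw [Measure.volume_eq_prod, Measure.measure_prod_null h1]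
    refine ae_of_all _ fun a => ?_
    have : Prod.mk a ⁻¹' {p : (ℝ × EuclideanSpace ℝ (Fin (k + 1))) × ℝ | p.2 = t p.1} = {t a} := by
      ext s
      simp
    simp [this]
  have h3 : ∀ᵐ p : (ℝ × EuclideanSpace ℝ (Fin (k + 1))) × ℝ, p.1.2 ≠ 0 := by
    have h0 : ∀ᵐ w : EuclideanSpace ℝ (Fin (k + 1)), w ≠ 0 := by
      rw [ae_iff]
      simp
    exact (Measure.quasiMeasurePreserving_snd.comp Measure.quasiMeasurePreserving_fst).ae h0
  filter_upwards [h2, h3] with p hp hp' using ⟨hp', hp⟩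

lemma integrable_box (K : ℝ) : Integrable
    (((Ioo (0 : ℝ) 1 ×ˢ Metric.ball (0 : EuclideanSpace ℝ (Fin (k + 1))) 1) ×ˢ
      Icc (-K) K).indicator fun _ => (1 : ℝ)) := by
  refine (integrable_indicator_iff
    ((measurableSet_Ioo.prod measurableSet_ball).prod measurableSet_Icc)).2 (integrableOn_const ?_)
  rw [Measure.volume_eq_prod, Measure.prod_prod, Measure.volume_eq_prod, Measure.prod_prod]
  exact ENNReal.mul_ne_top (ENNReal.mul_ne_top (by simp) measure_ball_lt_top.ne) (by simp)

lemma tendsto_integral_rescaledIntegrand (hκ₁ : κ₀ ∈ Icc (0 : ℝ) 1)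
    (hκ : ∀ r : ℝ, 0 < r → κ r ∈ Ico (0 : ℝ) 1) (hκ₀ : Tendsto κ (𝓝[>] 0) (𝓝 κ₀))
    (hφ : ContDiff ℝ ∞ φ) (hp : gradient φ x ≠ 0)
    (hO : ∀ᶠ y in 𝓝 x, ‖gradient φ y‖ • O y (EuclideanSpace.single 0 1) = gradient φ y)
    (hOc : ∀ (v : ℝ × EuclideanSpace ℝ (Fin (k + 2)) → EuclideanSpace ℝ (Fin (k + 2)))
      (v₀ : EuclideanSpace ℝ (Fin (k + 2))), Tendsto v (𝓝[>] 0 ×ˢ 𝓝 x) (𝓝 v₀) →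
        Tendsto (fun q => O q.2 (v q)) (𝓝[>] 0 ×ˢ 𝓝 x) (𝓝 (O x v₀))) (m : ℝ) :
    Integrable (limitIntegrand κ₀ (limitHeight (gradient φ x) (hessian φ x) (O x) m)) ∧
    Tendsto (fun q : ℝ × EuclideanSpace ℝ (Fin (k + 2)) => ∫ p, rescaledIntegrand k (κ q.1) q.1
      (halfspaceDiscrepancy (rescaledSublevel φ (O q.2) q.1 m q.2)) p) (𝓝[>] 0 ×ˢ 𝓝 x)
      (𝓝 (∫ p, limitIntegrand κ₀ (limitHeight (gradient φ x) (hessian φ x) (O x) m) p)) := by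
  obtain ⟨K, hK⟩ := exists_bound_rescaledIntegrand hκ hφ hp hO m
  have hmt := measurable_limitHeight (gradient φ x) (hessian φ x) (O x) m κ₀
  have hlim : ∀ᵐ p, Tendsto (fun q : ℝ × EuclideanSpace ℝ (Fin (k + 2)) =>
      rescaledIntegrand k (κ q.1) q.1
        (halfspaceDiscrepancy (rescaledSublevel φ (O q.2) q.1 m q.2)) p) (𝓝[>] 0 ×ˢ 𝓝 x)
      (𝓝 (limitIntegrand κ₀ (limitHeight (gradient φ x) (hessian φ x) (O x) m) p)) := by
    filter_upwards [ae_ne_graph hmt] with p hp'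
    exact tendsto_rescaledIntegrand hκ₁ hκ₀ hφ hp hO hOc m hp'.1 hp'.2
  refine ⟨(integrable_box K).mono' (measurable_limitIntegrand hmt).aestronglyMeasurable ?_,
    tendsto_integral_filter_of_dominated_convergence _ ?_ (hK.mono fun q hq => ae_of_all _ hq)
      (integrable_box K) hlim⟩
  -- The limit inherits the dominating bound, hence integrability.
  · filter_upwards [hlim] with p hp'
    exact le_of_tendsto hp'.norm (hK.mono fun q hq => hq p)
  · exact Eventually.of_forall fun q => (measurable_rescaledIntegrand
      (measurable_halfspaceDiscrepancy
        (measurableSet_rescaledSublevel hφ.continuous _ _ _ _))).aestronglyMeasurable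

lemma integral_limitIntegrand {t : ℝ → EuclideanSpace ℝ (Fin (k + 1)) → ℝ}
    (hi : Integrable (limitIntegrand κ₀ t)) :
    ∫ p, limitIntegrand κ₀ t p = ∫ u in (0 : ℝ)..1, (κ₀ + (1 - κ₀) * u) ^ k *
      ∫ w in Metric.ball (0 : EuclideanSpace ℝ (Fin (k + 1))) 1, t (κ₀ + (1 - κ₀) * u) w := by
  rw [Measure.volume_eq_prod, integral_prod _ (by exact hi), Measure.volume_eq_prod,
    integral_prod _ (by exact hi.integral_prod_left), intervalIntegral.integral_of_le zero_le_one,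
    integral_Ioc_eq_integral_Ioo, ← integral_indicator measurableSet_Ioo]
  refine integral_congr_ae (ae_of_all _ fun u => ?_)
  simp only
  by_cases hu : u ∈ Ioo (0 : ℝ) 1
  · rw [indicator_of_mem hu, ← integral_indicator measurableSet_ball, ← integral_const_mul]
    refine integral_congr_ae (ae_of_all _ fun w => ?_)
    simp only
    by_cases hw : ‖w‖ < 1
    · rw [indicator_of_mem (by simpa using hw)]
      simp only [limitIntegrand, if_pos (And.intro hu hw)]
      rw [integral_const_mul, integral_indicator_Iio_sub_Iic]
    · rw [indicator_of_notMem (by simpa using hw)]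
      simp only [limitIntegrand, if_neg (fun h : u ∈ Ioo (0 : ℝ) 1 ∧ ‖w‖ < 1 => hw h.2)]
      simp
  · rw [indicator_of_notMem hu]
    have : ∀ w s, limitIntegrand κ₀ t ((u, w), s) = 0 := fun w s => if_neg fun h => hu h.1
    simp [this]

/-- With `T` the tangential trace, the integral is a positive multiple of `m ∫ ρ^k - T / (2(k+1)) ∫
ρ^(k+2)`, that is, of `(m - c_A T) ∫ ρ^k`. -/
lemma integral_limitIntegrand_pos (hκ₁ : κ₀ ∈ Icc (0 : ℝ) 1) {p : EuclideanSpace ℝ (Fin (k + 2))}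
    (hp : p ≠ 0) {X : EuclideanSpace ℝ (Fin (k + 2)) →L[ℝ] EuclideanSpace ℝ (Fin (k + 2))}
    {O : EuclideanSpace ℝ (Fin (k + 2)) ≃ₗᵢ[ℝ] EuclideanSpace ℝ (Fin (k + 2))}
    (hO : ‖p‖ • O (EuclideanSpace.single 0 1) = p) {m : ℝ}
    (hm : levelSetSpeed (stencilConstant (k + 2) κ₀) p X < m)
    (hi : Integrable (limitIntegrand κ₀ (limitHeight p X O m))) :
    0 < ∫ p', limitIntegrand κ₀ (limitHeight p X O m) p' := by
  have hpos : 0 < ‖p‖ := norm_pos_iff.2 hp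
  have hOp : O (EuclideanSpace.single 0 1) = ‖p‖⁻¹ • p := by
    conv_rhs => rw [← hO]
    rw [smul_smul, hO, inv_mul_cancel₀ hpos.ne', one_smul]
  rw [integral_limitIntegrand hi]
  simp only [setIntegral_limitHeight, hOp]
  set T := LinearMap.trace ℝ _
    (X : EuclideanSpace ℝ (Fin (k + 2)) →ₗ[ℝ] EuclideanSpace ℝ (Fin (k + 2))) -
      inner ℝ (‖p‖⁻¹ • p) (X (‖p‖⁻¹ • p)) with hT
  set J := ∫ w in Metric.ball (0 : EuclideanSpace ℝ (Fin (k + 1))) 1, ‖w‖ with hJ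
  have hJpos : 0 < J := integral_norm_ball_pos
  have hexp : ∀ u : ℝ, (κ₀ + (1 - κ₀) * u) ^ k *
      (J / ‖p‖ * (m - (κ₀ + (1 - κ₀) * u) ^ 2 * (T / (2 * ((k : ℝ) + 1))))) =
      J / ‖p‖ * (m * (κ₀ + (1 - κ₀) * u) ^ k -
        T / (2 * ((k : ℝ) + 1)) * (κ₀ + (1 - κ₀) * u) ^ (k + 2)) := fun u => by ring
  simp only [hexp]
  have hci : ∀ j : ℕ, IntervalIntegrable (fun u => (κ₀ + (1 - κ₀) * u) ^ j) volume 0 1 := fun j =>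
    Continuous.intervalIntegrable (by fun_prop) _ _
  rw [intervalIntegral.integral_const_mul, intervalIntegral.integral_sub
    ((hci k).const_mul m) ((hci (k + 2)).const_mul _), intervalIntegral.integral_const_mul,
    intervalIntegral.integral_const_mul]
  refine mul_pos (div_pos hJpos hpos) (sub_pos.2 ?_)
  have hc := stencilConstant_mul_integral hκ₁ k
  calc T / (2 * (k + 1)) * ∫ u in (0 : ℝ)..1, (κ₀ + (1 - κ₀) * u) ^ (k + 2)
      = levelSetSpeed (stencilConstant (k + 2) κ₀) p X *
        ∫ u in (0 : ℝ)..1, (κ₀ + (1 - κ₀) * u) ^ k := by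
        rw [levelSetSpeed, ← hT, mul_right_comm, hc]
        ring
    _ < _ := mul_lt_mul_of_pos_right hm (integral_radius_pow_pos hκ₁ k)

theorem eventually_half_lt_volume_sublevel_of_gradient_ne_zero
    (hκ : ∀ r : ℝ, 0 < r → κ r ∈ Ico (0 : ℝ) 1) (hκ₀ : Tendsto κ (𝓝[>] 0) (𝓝 κ₀))
    (hφ : ContDiff ℝ ∞ φ) (hp : gradient φ x ≠ 0) {m : ℝ}
    (hm : levelSetSpeed (stencilConstant (k + 2) κ₀) (gradient φ x) (hessian φ x) < m) :
    ∀ᶠ q : ℝ × EuclideanSpace ℝ (Fin (k + 2)) in 𝓝[>] 0 ×ˢ 𝓝 x,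
      volume.real (annulus (κ q.1) q.1 q.2) <
        2 * volume.real (annulus (κ q.1) q.1 q.2 ∩ {y | φ y < φ q.2 + m * q.1 ^ 2}) := by
  have hκ₁ : κ₀ ∈ Icc (0 : ℝ) 1 := isClosed_Icc.mem_of_tendsto hκ₀ <| by
    filter_upwards [self_mem_nhdsWithin] with r hr using Ico_subset_Icc_self (hκ r hr)
  obtain ⟨O, hOe, hOt⟩ := exists_isometry_family (EuclideanSpace.single (0 : Fin (k + 2)) (1 : ℝ))
    (‖gradient φ x‖⁻¹ • gradient φ x) (by simp)
  have hgc := (continuous_gradient hφ).tendsto x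
  have hne : ∀ᶠ y in 𝓝 x, gradient φ y ≠ 0 := hgc.eventually_ne hp
  have hunit : ∀ y, gradient φ y ≠ 0 →
      ‖gradient φ y‖ • O (‖gradient φ y‖⁻¹ • gradient φ y) (EuclideanSpace.single 0 1) =
        gradient φ y := fun y hy => by
    have := norm_ne_zero_iff.2 hy
    rw [hOe _ (by rw [norm_smul, norm_inv, norm_norm, inv_mul_cancel₀ this]), smul_smul,
      mul_inv_cancel₀ this, one_smul]
  obtain ⟨hi, hlim⟩ := tendsto_integral_rescaledIntegrand
    (O := fun y => O (‖gradient φ y‖⁻¹ • gradient φ y)) hκ₁ hκ hκ₀ hφ hp (hne.mono hunit)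
    (fun v v₀ hv => hOt (((hgc.norm.inv₀ (norm_ne_zero_iff.2 hp)).smul hgc).comp tendsto_snd) hv) m
  have hpos := integral_limitIntegrand_pos hκ₁ hp (hunit x hp) hm hi
  filter_upwards [hlim.eventually_const_lt hpos,
    Eventually.prod_inl (p := fun r => 0 < r) self_mem_nhdsWithin _] with ⟨r, y⟩ hq hr
  simp only at hq hr ⊢
  set Oy := O (‖gradient φ y‖⁻¹ • gradient φ y)
  refine half_lt_of_similarity _ y hr Oy _ ?_
  have hS := measurableSet_rescaledSublevel hφ.continuous Oy r m y
  have hκr := hκ r hr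
  have hformula := setIntegral_annulus_eq_rescaled hκr hr (measurable_halfspaceDiscrepancy hS)
    (abs_halfspaceDiscrepancy_le _)
  have hint : 0 < ∫ z in annulus (κ r) 1 (0 : EuclideanSpace ℝ (Fin (k + 2))),
      halfspaceDiscrepancy (rescaledSublevel φ Oy r m y) z := by
    rw [hformula]
    have := sub_pos.2 hκr.2
    positivity
  set A := annulus (κ r) 1 (0 : EuclideanSpace ℝ (Fin (k + 2))) with hA
  set H := {v : EuclideanSpace ℝ (Fin (k + 2)) | v 0 ≤ 0} with hH
  have hHm : MeasurableSet H :=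
    (isClosed_le (by fun_prop : Continuous fun v : EuclideanSpace ℝ (Fin (k + 2)) => v 0)
      continuous_const).measurableSet
  have hAm : MeasurableSet A := measurableSet_annulus _ _ _
  have hfin : volume A ≠ ⊤ := volume_annulus_ne_top _ _ _
  have hind : ∀ s : Set (EuclideanSpace ℝ (Fin (k + 2))), MeasurableSet s →
      IntegrableOn (s.indicator fun _ => (1 : ℝ)) A := fun s hs =>
    IntegrableOn.indicator (integrableOn_const hfin) hs
  have hval : ∀ s : Set (EuclideanSpace ℝ (Fin (k + 2))), MeasurableSet s →
      ∫ z in A, s.indicator (fun _ => (1 : ℝ)) z = volume.real (A ∩ s) := fun s hs => by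
    rw [setIntegral_indicator hs]
    simp
  simp only [halfspaceDiscrepancy] at hint
  rw [integral_sub (hind _ hS) (hind _ hHm), hval _ hS, hval _ hHm] at hint
  -- The half-space already has at least half of the volume, so the positive discrepancy gives a
  -- strict majority.
  have hhalf := volume_annulus_le_two_mul_halfspace (κ r) 1
    (EuclideanSpace.single (0 : Fin (k + 2)) (1 : ℝ))
  have hH' : {z : EuclideanSpace ℝ (Fin (k + 2)) |
      inner ℝ (EuclideanSpace.single (0 : Fin (k + 2)) (1 : ℝ)) z ≤ 0} = H := by
    ext z
    simp [hH, EuclideanSpace.inner_single_left]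
  rw [hH'] at hhalf
  refine hhalf.trans_lt ?_
  have := sub_pos.1 hint
  have h2 : volume.real (A ∩ H) < volume.real (A ∩ {z | y + r • Oy z ∈ {y' | φ y' < φ y + m * r ^ 2}}) := this
  linarith

end NondegenerateGradient

/-! ### Combination of the two cases and conclusion. -/

theorem eventually_half_lt_volume_sublevel {d : ℕ} (hd : 2 ≤ d) {κ : ℝ → ℝ} {κ₀ : ℝ}
    (hκ : ∀ r : ℝ, 0 < r → κ r ∈ Ico (0 : ℝ) 1) (hκ₀ : Tendsto κ (𝓝[>] 0) (𝓝 κ₀))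
    {φ : EuclideanSpace ℝ (Fin d) → ℝ} (hφ : ContDiff ℝ ∞ φ) {x : EuclideanSpace ℝ (Fin d)}
    (hx : gradient φ x = 0 → hessian φ x = 0) {m : ℝ}
    (hm : levelSetSpeed (stencilConstant d κ₀) (gradient φ x) (hessian φ x) < m) :
    ∀ᶠ q : ℝ × EuclideanSpace ℝ (Fin d) in 𝓝[>] 0 ×ˢ 𝓝 x,
      volume.real (annulus (κ q.1) q.1 q.2) <
        2 * volume.real (annulus (κ q.1) q.1 q.2 ∩ {y | φ y < φ q.2 + m * q.1 ^ 2}) := by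
  by_cases hp : gradient φ x = 0
  · refine eventually_half_lt_volume_sublevel_of_degenerate hd hκ hφ (hx hp) ?_
    simpa [levelSetSpeed, hx hp] using hm
  · obtain ⟨k, rfl⟩ := Nat.exists_eq_add_of_le' hd
    exact eventually_half_lt_volume_sublevel_of_gradient_ne_zero hκ hκ₀ hφ hp hm

theorem mainTheorem8 (d : ℕ) (hd : 2 ≤ d)
    (κ : ℝ → ℝ) (κ₀ : ℝ)
    (hκ : ∀ r : ℝ, 0 < r → κ r ∈ Ico (0 : ℝ) 1)
    (hκ₀ : Tendsto κ (𝓝[>] 0) (𝓝 κ₀))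
    (φ : EuclideanSpace ℝ (Fin d) → ℝ)
    (hφ : ContDiff ℝ ∞ φ) (hper : IsTorusPeriodic φ)
    (x : EuclideanSpace ℝ (Fin d))
    (hx : gradient φ x = 0 → hessian φ x = 0) :
    upperHalfRelaxedLimit (fun h y => (medianStep κ h φ y - φ y) / h) x
        ≤ upperEnvelope (symmetricPairs d)
            (scaledLevelSetLaplacian (stencilConstant d κ₀)) (gradient φ x, hessian φ x) ∧
    lowerEnvelope (symmetricPairs d)
        (scaledLevelSetLaplacian (stencilConstant d κ₀)) (gradient φ x, hessian φ x)
      ≤ lowerHalfRelaxedLimit (fun h y => (medianStep κ h φ y - φ y) / h) x := by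
  have hmem := levelSetSpeed_mem hd (stencilConstant d κ₀) hx
  have hS : (gradient φ x, hessian φ x) ∈ symmetricPairs d := isSymmetric_hessian hφ x
  have hr : ∀ᶠ q : ℝ × EuclideanSpace ℝ (Fin d) in 𝓝[>] 0 ×ˢ 𝓝 x, 0 < q.1 :=
    (eventually_mem_nhdsWithin (a := (0 : ℝ)) (s := Ioi 0)).prod_inl _
  refine ⟨(upperHalfRelaxedLimit_le fun m hm => ?_).trans (le_upperEnvelope_of_mem hS hmem),
    (lowerEnvelope_le_of_mem hS hmem).trans (le_lowerHalfRelaxedLimit fun m hm => ?_)⟩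
  · filter_upwards [eventually_half_lt_volume_sublevel hd hκ hκ₀ hφ hx hm, hr] with q hq h0
    have := continuousMedian_le hφ.continuous hq
    rw [medianStep, Real.sqrt_sq h0.le, div_le_iff₀ (by positivity)]
    linarith
  -- Replacing `φ` by `-φ` negates the speed, so the sublevel estimate applies with `-m`.
  · have hneg : levelSetSpeed (stencilConstant d κ₀) (gradient (fun y => -φ y) x)
        (hessian (fun y => -φ y) x) < -m := by
      rw [gradient_neg_fun, hessian_neg_fun, levelSetSpeed_neg]
      linarith
    have hx' : gradient (fun y => -φ y) x = 0 → hessian (fun y => -φ y) x = 0 := by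
      rw [gradient_neg_fun, hessian_neg_fun]
      simpa using hx
    filter_upwards [eventually_half_lt_volume_sublevel hd hκ hκ₀ hφ.neg hx' hneg, hr] with q hq h0
    have : φ q.2 + m * q.1 ^ 2 ≤ _ := le_continuousMedian hφ.continuous (κ := κ q.1) (r := q.1) (x := q.2)
      (m := φ q.2 + m * q.1 ^ 2) (by rwa [show -(φ q.2 + m * q.1 ^ 2) = -φ q.2 + -m * q.1 ^ 2 by ring])
    rw [medianStep, Real.sqrt_sq h0.le, le_div_iff₀ (by positivity)]
    linarith
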